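/- Consider a service facility with customer classes $i=1,\dots,m$, unlimited waiting room and no losses. Batches of customers arrive according to a Poisson process with rate $\lambda>0$. The batch sizes are i.i.d. copies of a random vector $\boldsymbol G=(G_1,\dots,G_m)\in\mathbb Z_+^m$ with $\mathbb E G_i<\infty$ for all $i$, and they are independent of the arrival epochs. For every $t$, the epochs and sizes of the batches arriving after $t$ are independent of everything that has happened in the facility up to time $t$. Class-$i$ customers are always served in batches of fixed size $K_i\ge 1$; the start of a class-$i$ service is delayed until $K_i$ class-$i$ customers not yet in service are present, and these customers leave immediately upon completion of their service. The number of servers, the service discipline and the service times are otherwise arbitrary, except that almost surely no service completion coincides with an external arrival and no two service completions coincide (the role played by continuous service-time distributions). Let $\boldsymbol X(t)\in\mathbb Z_+^m$ be the vector of numbers of customers of the classes in the facility at time $t$, including those in service. Assume that the steady-state distribution exists, i.e. there is a probability distribution $\pi$ on $\mathbb Z_+^m$ such that, almost surely, for every $\boldsymbol x\in\mathbb Z_+^m$, $$\lim_{T\to\infty}\frac1T\int_0^T \mathbf 1\{\boldsymbol X(s)=\boldsymbol x\}\,ds=\pi(\boldsymbol x),$$ and that for each class $i$ with $\mathbb E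 G_i>0$ the steady-state distribution just after class-$i$ departure epochs exists, i.e. there is a probability distribution $\pi_i$ on $\mathbb Z_+^m$ such that, with $t_{i,1}<t_{i,2}<\cdots$ the completion epochs of class-$i$ services, almost surely, for every $\boldsymbol x\in\mathbb Z_+^m$, $$\lim_{n\to\infty}\frac1n\sum_{\ell=1}^n\mathbf 1\{\boldsymbol X(t_{i,\ell})=\boldsymbol x\}=\pi_i(\boldsymbol x).$$ For $\mathbb E G_i=0$ let $\pi_i$ be an arbitrary probability distribution. Write $\boldsymbol z^{\boldsymbol x}=\prod_i z_i^{x_i}$, $L(\boldsymbol z)=\sum_{\boldsymbol x}\pi(\boldsymbol x)\boldsymbol z^{\boldsymbol x}$ and $S^c_i(\boldsymbol z)=\sum_{\boldsymbol x}\pi_i(\boldsymbol x)\boldsymbol z^{\boldsymbol x}$. Then for all $\boldsymbol z\in\mathbb C^m$ with $|z_i|\le 1$ for all $i$, $$\bigl(1-\mathbb E[\boldsymbol z^{\boldsymbol G}]\bigr)L(\boldsymbol z)=\sum_{i=1}^m\frac{1-z_i^{K_i}}{K_i}\,\mathbb E[G_i]\,S^c_i(\boldsymbol z).$$ -/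

import Mathlib

open MeasureTheory ProbabilityTheory Filter Topology
open scoped NNReal

namespace BatchService

noncomputable section

/-- The probability generating function `E[z^X] = ∑ₓ p(x) ∏ᵢ zᵢ ^ xᵢ` of a distribution `p` on
`ℤ₊^m`. -/
def pgf {m : ℕ} (p : PMF (Fin m → ℕ)) (z : Fin m → ℂ) : ℂ :=
  ∑' x : Fin m → ℕ, (((p x).toReal : ℝ) : ℂ) * ∏ i, z i ^ x i

/-- The mean of the `i`-th coordinate of a distribution `p` on `ℤ₊^m`
(meaningful when `FiniteMean p i`). -/
def mean {m : ℕ} (p : PMF (Fin m → ℕ)) (i : Fin m) : ℝ :=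
  ∑' x : Fin m → ℕ, (p x).toReal * (x i : ℝ)

/-- The `i`-th coordinate of the distribution `p` on `ℤ₊^m` has a finite mean. -/
def FiniteMean {m : ℕ} (p : PMF (Fin m → ℕ)) (i : Fin m) : Prop :=
  Summable fun x : Fin m → ℕ => (p x).toReal * (x i : ℝ)

/-- The jump `f(t) - f(t-)` of a counting function (there is no jump at time `0`). -/
def jump (f : ℝ≥0 → ℕ) (t : ℝ≥0) : ℕ := f t - Function.leftLim f t

/-- A sample path of a counting process: nondecreasing and right-continuous (hence with left
limits), with finite values. -/
structure IsCountingPath (f : ℝ≥0 → ℕ) : Prop where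
  mono : Monotone f
  rightCts : ∀ t, ContinuousWithinAt f (Set.Ici t) t

/-- An `m`-class single-node service facility without losses on the probability space `(Ω, P)`.
Batches of customers arrive according to a Poisson process with rate `rate`; their sizes are
i.i.d. with distribution `batch` on `ℤ₊^m`. Class-`i` customers are served in batches of the
fixed size `K i`, and such a service can start only when `K i` class-`i` customers that are not
yet in service are present. Nothing is prescribed about the number of servers, the service
discipline or the service times, except that arrivals do not depend on the past of the facility,
and that a service completion coincides neither with an arrival nor with another completion. -/
structure Facility (m : ℕ) (rate : ℝ≥0) (batch : PMF (Fin m → ℕ)) (K : Fin m → ℕ)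
    {Ω : Type*} [mΩ : MeasurableSpace Ω] (P : Measure Ω) where
  /-- The information available up to each time. -/
  ℱ : Filtration ℝ≥0 mΩ
  /-- The numbers of customers of all classes at time `0`. -/
  X₀ : Ω → Fin m → ℕ
  /-- `N t` is the number of batches that have arrived in `(0, t]`. -/
  N : ℝ≥0 → Ω → ℕ
  /-- `G n` is the size of the `n`-th arriving batch (`n = 0, 1, …`). -/
  G : ℕ → Ω → Fin m → ℕ
  /-- `S i t` is the number of class-`i` services started up to time `t`, including those in
  progress at time `0`. -/
  S : Fin m → ℝ≥0 → Ω → ℕ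
  /-- `D i t` is the number of class-`i` services completed in `(0, t]`. -/
  D : Fin m → ℝ≥0 → Ω → ℕ
  N_zero : ∀ ω, N 0 ω = 0
  D_zero : ∀ i ω, D i 0 ω = 0
  N_path : ∀ ω, IsCountingPath fun t => N t ω
  S_path : ∀ i ω, IsCountingPath fun t => S i t ω
  D_path : ∀ i ω, IsCountingPath fun t => D i t ω
  -- everything that has happened up to time `t` is known at time `t`
  X₀_meas : Measurable[ℱ 0] X₀
  N_adapted : ∀ t, Measurable[ℱ t] (N t)
  A_adapted : ∀ i t, Measurable[ℱ t] fun ω => ∑ n ∈ Finset.range (N t ω), G n ω i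
  S_adapted : ∀ i t, Measurable[ℱ t] (S i t)
  D_adapted : ∀ i t, Measurable[ℱ t] (D i t)
  -- batch Poisson arrivals
  G_meas : ∀ n, Measurable (G n)
  G_law : ∀ n, P.map (G n) = batch.toMeasure
  G_iIndep : iIndepFun G P
  N_law : ∀ s t, s ≤ t → P.map (fun ω => N t ω - N s ω) = poissonMeasure (rate * (t - s))
  N_indep_G : IndepFun (fun ω => fun t => N t ω) (fun ω => fun n => G n ω) P
  /-- The epochs and the sizes of the batches that arrive after time `s` are independent of the
  information available at time `s`. -/
  nonanticipating : ∀ s, Indep (ℱ s) (MeasurableSpace.comap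
    (fun ω => ((fun t : ℝ≥0 => N (s + t) ω - N s ω), (fun n : ℕ => G (N s ω + n) ω)))
    inferInstance) P
  /-- A service is completed only after it has started. -/
  completed_le_started : ∀ i t ω, D i t ω ≤ S i t ω
  /-- Each class-`i` service takes `K i` customers of class `i` that are present and not taken by
  another service; so its start is delayed until `K i` such customers are present. -/
  started_le_arrived : ∀ i t ω,
    K i * S i t ω ≤ X₀ ω i + ∑ n ∈ Finset.range (N t ω), G n ω i
  /-- An external arrival and a service completion never occur simultaneously. -/
  arrival_ne_completion : ∀ᵐ ω ∂P, ∀ t i j,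
    jump (fun s => ∑ n ∈ Finset.range (N s ω), G n ω i) t = 0 ∨ jump (fun s => D j s ω) t = 0
  /-- Two services are never completed simultaneously. -/
  completion_single : ∀ᵐ ω ∂P, ∀ t, ∑ i, jump (fun s => D i s ω) t ≤ 1

namespace Facility

variable {m : ℕ} {rate : ℝ≥0} {batch : PMF (Fin m → ℕ)} {K : Fin m → ℕ}
  {Ω : Type*} [MeasurableSpace Ω] {P : Measure Ω}

/-- `A i t` is the number of class-`i` customers that have arrived in `(0, t]`. -/
def A (F : Facility m rate batch K P) (i : Fin m) (t : ℝ≥0) (ω : Ω) : ℕ :=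
  ∑ n ∈ Finset.range (F.N t ω), F.G n ω i

/-- The queue-length vector: the numbers of customers of all classes in the facility at time `t`,
including those in service. Each completed class-`i` service removes `K i` customers. The
subtraction is never truncated, since `K i * D i t ≤ K i * S i t ≤ X₀ i + A i t`. -/
def X (F : Facility m rate batch K P) (t : ℝ≥0) (ω : Ω) : Fin m → ℕ :=
  fun i => F.X₀ ω i + F.A i t ω - K i * F.D i t ω

/-- The epoch at which the `n`-th class-`i` service (`n = 0, 1, …`) is completed, if there is
one. -/
def departureEpoch (F : Facility m rate batch K P) (i : Fin m) (n : ℕ) (ω : Ω) : ℝ≥0 :=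
  sInf {t | n < F.D i t ω}

/-- `p` is the steady-state joint queue-length distribution: almost surely, the long-run fraction
of time that is spent in each state `x` is `p x`. -/
def IsSteadyState (F : Facility m rate batch K P) (p : PMF (Fin m → ℕ)) : Prop :=
  ∀ᵐ ω ∂P, ∀ x : Fin m → ℕ, Tendsto
    (fun T : ℝ => (∫ s in (0 : ℝ)..T, if F.X s.toNNReal ω = x then (1 : ℝ) else 0) / T)
    atTop (𝓝 (p x).toReal)

/-- `p` is the steady-state joint queue-length distribution immediately after departure epochs of
class `i`: almost surely, the long-run fraction of class-`i` departure epochs after which the state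
is `x` is `p x`, for each `x`. -/
def IsSteadyStateAfterDeparture (F : Facility m rate batch K P) (i : Fin m)
    (p : PMF (Fin m → ℕ)) : Prop :=
  ∀ᵐ ω ∂P, ∀ x : Fin m → ℕ, Tendsto
    (fun n : ℕ => (∑ k ∈ Finset.range n,
      if F.X (F.departureEpoch i k ω) ω = x then (1 : ℝ) else 0) / n)
    atTop (𝓝 (p x).toReal)

end Facility

end

end BatchService

namespace BatchService

/-! The proof is a rate-conservation argument for $z^{X(t)}$. A class-$i$ completion at time $t$
removes $K_i$ customers, so it makes $z^X$ jump by $(1-z_i^{K_i})z^{X(t)}$. Subtracting all these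
jumps (`compensated`) leaves a process that moves only at arrivals. Over a step of length $h$ the
arrivals multiply $z^X$ by a factor independent of the past, with mean $\exp(-\lambda h(1-\mathbb E
z^G))$. Hence adding $\lambda(1-\mathbb E z^G)\int_0^T z^{X(s)}ds$ compensates the arrivals as well
and gives `arrivalMartingale`, $M(T)$.

Only the second moment of $M(T)$ is needed. Almost surely $M(T)$ is the limit of sums over refining
grids (`ae_tendsto_centredSum`); the terms of each sum are orthogonal (`integral_norm_sum_sq_le`),
with total variance at most $4\lambda T$ on every grid, and Fatou's lemma carries this bound to
$M(T)$.

Now divide by $T$. The time integral tends to $L(z)$, the bounded term $z^{X(T)}$ disappears, and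
the departure sums tend to $\lambda\mathbb E[G_i]K_i^{-1}S^c_i(z)$ because
$D_i(T)/T\to\lambda\mathbb E[G_i]/K_i$ (`tendsto_D_div`). So $M(T)/T$ converges almost surely to a
constant, while its second moment is at most $4\lambda/T$; by Fatou the constant is $0$, which is
$\lambda$ times the identity.

The departure rate follows from the balance $X_i+K_iD_i=X_{0,i}+A_i$, the strong law for $A_i$, and
$X_i(T)/T\to0$ (`tendsto_X_div`). The last holds because the steady state forces $X_i$ to be bounded
by a constant at some time shortly before $T$, after which it grows at most by the arrivals. -/

/-- The monomial `z ^ x = ∏ᵢ zᵢ ^ xᵢ`. -/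
def monom {m : ℕ} (z : Fin m → ℂ) (x : Fin m → ℕ) : ℂ := ∏ i, z i ^ x i

lemma monom_add {m : ℕ} (z : Fin m → ℂ) (x y : Fin m → ℕ) :
    monom z (x + y) = monom z x * monom z y := by
  simp [monom, pow_add, Finset.prod_mul_distrib]

lemma monom_zero {m : ℕ} (z : Fin m → ℂ) : monom z 0 = 1 := by
  simp [monom]

lemma monom_single {m : ℕ} (z : Fin m → ℂ) (i : Fin m) (k : ℕ) :
    monom z (Pi.single i k) = z i ^ k := by
  unfold monom
  rw [Finset.prod_eq_single i]
  · simp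
  · intro j _ hj
    simp [Pi.single_eq_of_ne hj]
  · simp

lemma norm_monom_le_one {m : ℕ} {z : Fin m → ℂ} (hz : ∀ i, ‖z i‖ ≤ 1) (x : Fin m → ℕ) :
    ‖monom z x‖ ≤ 1 := by
  unfold monom
  rw [norm_prod]
  refine Finset.prod_le_one (fun _ _ => norm_nonneg _) fun i _ => ?_
  rw [norm_pow]
  exact pow_le_one₀ (norm_nonneg _) (hz i)

/-! ### Pathwise analysis: jumps of $z^X$ at arrivals and departures. -/

namespace IsCountingPath

variable {f : ℝ≥0 → ℕ}

lemma eventually_eq_right (hf : IsCountingPath f) (t : ℝ≥0) : ∀ᶠ s in 𝓝[≥] t, f s = f t := by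
  have h := hf.rightCts t
  rw [ContinuousWithinAt, nhds_discrete, tendsto_pure] at h
  exact h

lemma eventually_eq_left (hf : IsCountingPath f) (t : ℝ≥0) :
    ∀ᶠ s in 𝓝[<] t, f s = Function.leftLim f t := by
  have h := hf.mono.tendsto_leftLim t
  rw [nhds_discrete, tendsto_pure] at h
  exact h

lemma comp (hf : IsCountingPath f) {g : ℕ → ℕ} (hg : Monotone g) :
    IsCountingPath fun t => g (f t) :=
  ⟨hg.comp hf.mono, fun t =>
    (continuous_of_discreteTopology (f := g)).continuousAt.comp_continuousWithinAt (hf.rightCts t)⟩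

/-- Near `t`, a counting path takes only its left limit and its value at `t`. -/
lemma eventually_nhds (hf : IsCountingPath f) (t : ℝ≥0) :
    ∀ᶠ s in 𝓝 t, (s < t → f s = Function.leftLim f t) ∧ (t ≤ s → f s = f t) := by
  have h1 := eventually_nhdsWithin_iff.1 (hf.eventually_eq_left t)
  have h2 := eventually_nhdsWithin_iff.1 (hf.eventually_eq_right t)
  filter_upwards [h1, h2] with s hs1 hs2
  exact ⟨hs1, hs2⟩

end IsCountingPath

/-- A property of intervals that holds locally holds for all short intervals in `[0, T]`. -/
lemma exists_forall_short_interval {p : ℝ≥0 → ℝ≥0 → Prop}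
    (hp : ∀ t, ∃ U ∈ 𝓝 t, ∀ a ∈ U, ∀ b ∈ U, a ≤ b → p a b) (T : ℝ≥0) :
    ∃ δ > (0 : ℝ), ∀ a b, a ≤ b → b ≤ T → dist b a < δ → p a b := by
  choose U hU hp using hp
  -- A Lebesgue number of the cover of the compact interval by the good neighbourhoods serves as
  -- `δ`.
  obtain ⟨δ, hδ, h⟩ := lebesgue_number_lemma_of_metric (s := Set.Icc 0 T)
    (c := fun t => interior (U t)) isCompact_Icc (fun _ => isOpen_interior)
    (fun t _ => Set.mem_iUnion.2 ⟨t, mem_interior_iff_mem_nhds.2 (hU t)⟩)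
  refine ⟨δ, hδ, fun a b hab hb hd => ?_⟩
  obtain ⟨t, ht⟩ := h a ⟨zero_le, hab.trans hb⟩
  exact hp t a (interior_subset (ht (Metric.mem_ball_self hδ))) b
    (interior_subset (ht (Metric.mem_ball.2 hd))) hab

namespace Facility

variable {m : ℕ} {rate : ℝ≥0} {batch : PMF (Fin m → ℕ)} {K : Fin m → ℕ}
  {Ω : Type*} [MeasurableSpace Ω] {P : Measure Ω}

lemma A_path (F : Facility m rate batch K P) (i : Fin m) (ω : Ω) :
    IsCountingPath fun t => F.A i t ω :=
  (F.N_path ω).comp (g := fun k => ∑ n ∈ Finset.range k, F.G n ω i) fun _ _ h =>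
    Finset.sum_le_sum_of_subset (Finset.range_mono h)

/-- The balance of the customers of class `i`. -/
lemma X_add (F : Facility m rate batch K P) (t : ℝ≥0) (ω : Ω) (i : Fin m) :
    F.X t ω i + K i * F.D i t ω = F.X₀ ω i + F.A i t ω := by
  have h := F.started_le_arrived i t ω
  have h2 := Nat.mul_le_mul_left (K i) (F.completed_le_started i t ω)
  exact Nat.sub_add_cancel (h2.trans h)

/-- `z ^ X(t)`, compensated for the departures up to time `t`. -/
noncomputable def compensated (F : Facility m rate batch K P) (z : Fin m → ℂ) (t : ℝ≥0) (ω : Ω) :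
    ℂ :=
  monom z (F.X t ω) - ∑ i, (1 - z i ^ K i) *
    ∑ l ∈ Finset.range (F.D i t ω), monom z (F.X (F.departureEpoch i l ω) ω)

/-- `z ^ Y` for the vector `Y` of the numbers of customers that arrive in `(a, b]`. -/
noncomputable def arrivalFactor (F : Facility m rate batch K P) (z : Fin m → ℂ) (a b : ℝ≥0)
    (ω : Ω) : ℂ :=
  monom z fun i => F.A i b ω - F.A i a ω

lemma compensated_sub_of_D_eq (F : Facility m rate batch K P) (z : Fin m → ℂ) {a b : ℝ≥0}
    (hab : a ≤ b) {ω : Ω} (hD : ∀ i, F.D i a ω = F.D i b ω) :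
    F.compensated z b ω - F.compensated z a ω =
      monom z (F.X a ω) * (F.arrivalFactor z a b ω - 1) := by
  have hX : F.X b ω = F.X a ω + fun i => F.A i b ω - F.A i a ω := by
    funext i
    have h1 := F.X_add a ω i
    have h2 := F.X_add b ω i
    have h3 := (F.A_path i ω).mono hab
    simp only [Pi.add_apply]
    rw [hD i] at h1
    omega
  simp only [compensated, hX, monom_add, arrivalFactor, hD]
  ring

/-- With one completion, at `t`, and no arrival in `(a, b]`, $X(a)=X(b)+K_je_j$. So $z^X$ changes by
$(1-z_j^{K_j})z^{X(b)}$, which is exactly the newly subtracted term, and both sides vanish. -/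
lemma compensated_sub_of_completion (F : Facility m rate batch K P) (z : Fin m → ℂ) {a t b : ℝ≥0}
    (hat : a < t) (htb : t ≤ b) {ω : Ω} (hA : ∀ i, F.A i a ω = F.A i b ω) {j : Fin m}
    (hj : F.D j t ω = F.D j a ω + 1) (hlt : ∀ s < t, F.D j s ω ≤ F.D j a ω)
    (hbt : ∀ i, F.D i b ω = F.D i t ω) (hD : ∀ i, i ≠ j → F.D i b ω = F.D i a ω) :
    F.compensated z b ω - F.compensated z a ω =
      monom z (F.X a ω) * (F.arrivalFactor z a b ω - 1) := by
  have hX : F.X a ω = F.X b ω + Pi.single j (K j) := by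
    funext i
    have h1 := F.X_add a ω i
    have h2 := F.X_add b ω i
    rw [← hA i] at h2
    rcases eq_or_ne i j with rfl | hij
    · rw [hbt, hj, mul_add] at h2
      simp only [Pi.add_apply, Pi.single_eq_same]
      omega
    · rw [hD i hij] at h2
      simp only [Pi.add_apply, Pi.single_eq_of_ne hij]
      omega
  have hXtb : F.X t ω = F.X b ω := by
    funext i
    have h1 := F.X_add t ω i
    have h2 := F.X_add b ω i
    have h3 := (F.A_path i ω).mono hat.le
    have h4 := (F.A_path i ω).mono htb
    have h5 := hA i
    rw [hbt i] at h2
    omega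
  -- Services are numbered from `0`, so the completion after the first `D j a` ones has index `D j
  -- a`.
  have hep : F.departureEpoch j (F.D j a ω) ω = t := by
    unfold departureEpoch
    refine IsLeast.csInf_eq ⟨?_, fun s hs => ?_⟩
    · simp [hj]
    · by_contra hst
      exact absurd (hlt s (not_le.1 hst)) (not_le.2 hs)
  have hW : F.arrivalFactor z a b ω = 1 := by
    have : (fun i => F.A i b ω - F.A i a ω) = 0 := by
      funext i
      simp [hA i]
    rw [arrivalFactor, this, monom_zero]
  have hsum : ∑ i, (1 - z i ^ K i) *
        ∑ l ∈ Finset.range (F.D i b ω), monom z (F.X (F.departureEpoch i l ω) ω) =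
      ∑ i, (1 - z i ^ K i) *
        ∑ l ∈ Finset.range (F.D i a ω), monom z (F.X (F.departureEpoch i l ω) ω) +
      (1 - z j ^ K j) * monom z (F.X b ω) := by
    rw [← sub_eq_iff_eq_add', ← Finset.sum_sub_distrib, Finset.sum_eq_single j]
    · rw [hbt, hj, Finset.sum_range_succ, hep, hXtb]
      ring
    · intro i _ hij
      rw [hD i hij, sub_self]
    · simp
  rw [hW, compensated, compensated, hsum, hX, monom_add, monom_single]
  ring

/-- Over an interval that is short enough, `z ^ X`, compensated for the departures, changes only
by the arrivals. -/
lemma compensated_sub_local (F : Facility m rate batch K P) (z : Fin m → ℂ) {ω : Ω}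
    (hac : ∀ t i j, jump (fun s => F.A i s ω) t = 0 ∨ jump (fun s => F.D j s ω) t = 0)
    (hcs : ∀ t, ∑ i, jump (fun s => F.D i s ω) t ≤ 1) (t : ℝ≥0) :
    ∃ U ∈ 𝓝 t, ∀ a ∈ U, ∀ b ∈ U, a ≤ b →
      F.compensated z b ω - F.compensated z a ω =
        monom z (F.X a ω) * (F.arrivalFactor z a b ω - 1) := by
  have hA := eventually_all.2 fun i => (F.A_path i ω).eventually_nhds t
  have hD := eventually_all.2 fun i => (F.D_path i ω).eventually_nhds t
  refine ⟨_, hA.and hD, ?_⟩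
  rintro a ⟨haA, haD⟩ b ⟨hbA, hbD⟩ hab
  -- Near `t` all jumps occur at `t` itself, so a departure can matter only if `a < t ≤ b`.
  rcases lt_or_ge b t with hbt | hbt
  · refine F.compensated_sub_of_D_eq z hab fun i => ?_
    rw [(haD i).1 (hab.trans_lt hbt), (hbD i).1 hbt]
  rcases le_or_gt t a with hta | hat
  · refine F.compensated_sub_of_D_eq z hab fun i => ?_
    rw [(haD i).2 hta, (hbD i).2 hbt]
  have hjD : ∀ i, F.D i t ω = F.D i a ω + jump (fun s => F.D i s ω) t := by
    intro i
    have h1 := (haD i).1 hat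
    have h2 : F.D i a ω ≤ F.D i t ω := (F.D_path i ω).mono hat.le
    simp only [jump]
    rw [← h1]
    omega
  by_cases h0 : ∀ i, jump (fun s => F.D i s ω) t = 0
  · refine F.compensated_sub_of_D_eq z hab fun i => ?_
    rw [(hbD i).2 hbt, hjD i, h0 i, add_zero]
  obtain ⟨j, hj⟩ := not_forall.1 h0
  have hsum := hcs t
  rw [← Finset.add_sum_erase _ _ (Finset.mem_univ j)] at hsum
  have hj1 : jump (fun s => F.D j s ω) t = 1 := by omega
  have hrest : ∀ i, i ≠ j → jump (fun s => F.D i s ω) t = 0 := by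
    intro i hij
    have := Finset.single_le_sum (f := fun i => jump (fun s => F.D i s ω) t)
      (fun _ _ => Nat.zero_le _) (Finset.mem_erase.2 ⟨hij, Finset.mem_univ i⟩)
    omega
  refine F.compensated_sub_of_completion z hat hbt (fun i => ?_) (j := j) ?_ ?_ ?_ ?_
  · have h1 := (hac t i j).resolve_right hj
    have h2 := (haA i).1 hat
    have h3 := (hbA i).2 hbt
    have h4 : F.A i a ω ≤ F.A i t ω := (F.A_path i ω).mono hat.le
    simp only [jump] at h1
    rw [← h2] at h1
    omega
  · rw [hjD j, hj1]
  · intro s hs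
    rcases le_or_gt s a with hsa | hsa
    · exact (F.D_path j ω).mono hsa
    · refine le_of_not_gt fun hlt => ?_
      have h1 : F.D j s ω ≤ Function.leftLim (fun s => F.D j s ω) t :=
        (F.D_path j ω).mono.le_leftLim hs
      rw [← (haD j).1 hat] at h1
      omega
  · exact fun i => (hbD i).2 hbt
  · intro i hij
    rw [(hbD i).2 hbt, hjD i, hrest i hij, add_zero]

/-- On a grid that is fine enough, the increment of the compensated `z ^ X` is the sum of the
changes by the arrivals. -/
lemma eventually_compensated_sub_eq_sum (F : Facility m rate batch K P) (z : Fin m → ℂ) {ω : Ω}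
    (hac : ∀ t i j, jump (fun s => F.A i s ω) t = 0 ∨ jump (fun s => F.D j s ω) t = 0)
    (hcs : ∀ t, ∑ i, jump (fun s => F.D i s ω) t ≤ 1) (T : ℕ) :
    ∀ᶠ n : ℕ in atTop, F.compensated z T ω - F.compensated z 0 ω =
      ∑ k ∈ Finset.range (n * T), monom z (F.X (k / n) ω) *
        (F.arrivalFactor z (k / n) ((k + 1 : ℕ) / n) ω - 1) := by
  obtain ⟨δ, hδ, h⟩ := exists_forall_short_interval (F.compensated_sub_local z hac hcs) T
  filter_upwards [eventually_gt_atTop 0,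
    (tendsto_one_div_atTop_nhds_zero_nat (𝕜 := ℝ)).eventually (gt_mem_nhds hδ)] with n hn hnδ
  have hn' : (n : ℝ≥0) ≠ 0 := by exact_mod_cast hn.ne'
  have hstep : ∀ k ∈ Finset.range (n * T), monom z (F.X (k / n) ω) *
        (F.arrivalFactor z (k / n) ((k + 1 : ℕ) / n) ω - 1) =
      F.compensated z ((k + 1 : ℕ) / n) ω - F.compensated z (k / n) ω := by
    intro k hk
    refine (h _ _ ?_ ?_ ?_).symm
    · gcongr
      exact k.le_succ
    · have : ((k + 1 : ℕ) : ℝ≥0) ≤ n * T := by exact_mod_cast Finset.mem_range.1 hk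
      exact div_le_of_le_mul₀ zero_le zero_le (by rwa [mul_comm])
    · rw [NNReal.dist_eq]
      push_cast
      rw [← sub_div, add_sub_cancel_left, abs_of_nonneg (by positivity)]
      exact hnδ
  -- The increments of `compensated` telescope over the grid.
  rw [Finset.sum_congr rfl hstep,
    Finset.sum_range_sub fun k : ℕ => F.compensated z ((k : ℝ≥0) / n) ω]
  simp [hn']

end Facility

/-! ### Averages of bounded functions: steady-state limits and Riemann sums. -/

lemma hasSum_toReal {α : Type*} (p : PMF α) : HasSum (fun x => (p x).toReal) 1 := by
  have := ENNReal.hasSum_toReal (f := p) (by simp [p.tsum_coe])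
  simpa [← ENNReal.tsum_toReal_eq p.apply_ne_top, p.tsum_coe] using this

/-- Probability measures on a countable space whose point masses converge to those of a probability
distribution converge in the sense of integrals of bounded functions. -/
lemma tendsto_integral_of_tendsto_measureReal_singleton {ι E : Type*} {l : Filter ι} [Countable E]
    [MeasurableSpace E] [MeasurableSingletonClass E] {μ : ι → Measure E}
    (hμ : ∀ᶠ i in l, IsProbabilityMeasure (μ i)) (p : PMF E)
    (h : ∀ x, Tendsto (fun i => (μ i).real {x}) l (𝓝 (p x).toReal)) {f : E → ℂ}
    (hf : ∀ x, ‖f x‖ ≤ 1) :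
    Tendsto (fun i => ∫ x, f x ∂μ i) l (𝓝 (∑' x, (((p x).toReal : ℝ) : ℂ) * f x)) := by
  have hp : ∀ x, p.toMeasure.real {x} = (p x).toReal := fun x => by
    rw [measureReal_def, p.toMeasure_apply_singleton x (measurableSet_singleton x)]
  have hint : ∀ (ν : Measure E) [IsProbabilityMeasure ν], Integrable f ν := fun ν _ =>
    Integrable.of_bound (measurable_of_countable f).aestronglyMeasurable 1 (ae_of_all _ hf)
  have hlim : ∑' x, (((p x).toReal : ℝ) : ℂ) * f x = ∫ x, f x ∂p.toMeasure := by
    rw [p.integral_eq_tsum f (hint _)]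
    simp
  -- Truncating the integral to a finite set costs at most the mass outside it.
  have hsplit : ∀ (ν : Measure E) [IsProbabilityMeasure ν] (s : Finset E),
      ‖∫ x, f x ∂ν - ∑ x ∈ s, ν.real {x} • f x‖ ≤ 1 - ∑ x ∈ s, ν.real {x} := by
    intro ν _ s
    have h1 : ∫ x in (s : Set E), f x ∂ν = ∑ x ∈ s, ν.real {x} • f x :=
      setIntegral_finset s (hint ν).integrableOn
    rw [← h1, ← integral_add_compl s.measurableSet (hint ν), add_sub_cancel_left]
    refine (norm_setIntegral_le_of_norm_le_const (measure_lt_top _ _) fun x _ => hf x).trans ?_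
    rw [one_mul, probReal_compl_eq_one_sub s.measurableSet, sum_measureReal_singleton]
  rw [hlim, Metric.tendsto_nhds]
  intro ε hε
  -- This finite set carries mass above `1 - ε / 4` under `p`, hence eventually under `μ i`: no mass
  -- escapes. The two truncations and the finite sum then cost less than `ε / 4` each.
  obtain ⟨s, hs⟩ :=
    ((hasSum_toReal p).eventually (lt_mem_nhds (show 1 - ε / 4 < 1 by linarith))).exists
  have h1 : Tendsto (fun i => ∑ x ∈ s, (μ i).real {x} • f x) l
      (𝓝 (∑ x ∈ s, p.toMeasure.real {x} • f x)) :=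
    tendsto_finsetSum _ fun x _ => (hp x ▸ h x).smul_const _
  have h2 : Tendsto (fun i => ∑ x ∈ s, (μ i).real {x}) l (𝓝 (∑ x ∈ s, (p x).toReal)) :=
    tendsto_finsetSum _ fun x _ => h x
  filter_upwards [hμ, Metric.tendsto_nhds.1 h1 (ε / 4) (by positivity),
    h2.eventually (lt_mem_nhds hs)] with i hi hi1 hi2
  have h3 := hsplit (μ i) s
  have h4 := hsplit p.toMeasure s
  simp only [hp] at h4 hi1
  rw [dist_eq_norm] at hi1 ⊢
  have h5 := norm_add₃_le (a := ∫ x, f x ∂μ i - ∑ x ∈ s, (μ i).real {x} • f x)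
    (b := ∑ x ∈ s, (μ i).real {x} • f x - ∑ x ∈ s, (p x).toReal • f x)
    (c := ∑ x ∈ s, (p x).toReal • f x - ∫ x, f x ∂p.toMeasure)
  rw [sub_add_sub_cancel, sub_add_sub_cancel,
    norm_sub_rev (∑ x ∈ s, (p x).toReal • f x)] at h5
  linarith

/-- Left Riemann sums of a bounded function with countably many discontinuities. -/
lemma tendsto_riemannSum {g : ℝ≥0 → ℂ} (hg : ∀ t, ‖g t‖ ≤ 1)
    (hc : {t | ¬ ContinuousAt g t}.Countable) (T : ℕ) :
    Tendsto (fun n : ℕ => (∑ k ∈ Finset.range (n * T), g (k / n)) / (n : ℂ)) atTop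
      (𝓝 (∫ s in (0 : ℝ)..T, g s.toNNReal)) := by
  -- The Riemann sum is the integral of this step function, which tends to `g` at each continuity
  -- point since $\lfloor ns\rfloor/n\to s$; dominated convergence applies.
  set r : ℕ → ℝ → ℂ := fun n s => g ((⌊(n : ℝ) * s⌋₊ : ℝ≥0) / n) with hr
  have hrm : ∀ n, Measurable (r n) := fun n =>
    (measurable_of_countable fun k : ℕ => g ((k : ℝ≥0) / n)).comp
      (Nat.measurable_floor.comp (measurable_const.mul measurable_id))
  have hri : ∀ n a b, IntervalIntegrable (r n) volume a b := fun n a b =>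
    (intervalIntegrable_const (c := (1 : ℝ))).mono_fun (hrm n).aestronglyMeasurable
      (ae_of_all _ fun s => by simpa using hg _)
  have hsum : ∀ n : ℕ, 0 < n →
      ∫ s in (0 : ℝ)..T, r n s = (∑ k ∈ Finset.range (n * T), g (k / n)) / (n : ℂ) := by
    intro n hn
    have hn' : (n : ℝ) ≠ 0 := by exact_mod_cast hn.ne'
    have hn0 : (0 : ℝ) < n := by exact_mod_cast hn
    have h1 := intervalIntegral.sum_integral_adjacent_intervals (f := r n) (μ := volume)
      (a := fun k : ℕ => (k : ℝ) / n) (n := n * T) fun k _ => hri _ _ _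
    simp only [Nat.cast_zero, zero_div, Nat.cast_mul, mul_div_cancel_left₀ _ hn'] at h1
    rw [← h1, Finset.sum_div]
    refine Finset.sum_congr rfl fun k _ => ?_
    have h2 : ∫ s in ((k : ℝ) / n)..((k + 1 : ℕ) : ℝ) / n, r n s =
        ∫ s in ((k : ℝ) / n)..((k + 1 : ℕ) : ℝ) / n, g (k / n) := by
      -- The floor is `k` on the whole cell except its right endpoint, a null set.
      refine intervalIntegral.integral_congr_ae ?_
      filter_upwards [Measure.ae_ne volume (((k + 1 : ℕ) : ℝ) / n)] with s hs1 hs2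
      rw [Set.uIoc_of_le (by gcongr; exact k.le_succ)] at hs2
      have hlo : (k : ℝ) ≤ n * s := by
        have := (div_lt_iff₀ hn0).1 hs2.1
        linarith
      have hhi : n * s < (k : ℝ) + 1 := by
        have := (lt_div_iff₀ hn0).1 (lt_of_le_of_ne hs2.2 hs1)
        push_cast at this
        linarith
      have : ⌊(n : ℝ) * s⌋₊ = k :=
        (Nat.floor_eq_iff (le_trans (Nat.cast_nonneg k) hlo)).2 ⟨hlo, hhi⟩
      simp [hr, this]
    rw [h2, intervalIntegral.integral_const, ← sub_div]
    push_cast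
    rw [add_sub_cancel_left, Complex.real_smul]
    push_cast
    ring
  refine Tendsto.congr' ((eventually_gt_atTop 0).mono fun n hn => hsum n hn) ?_
  refine intervalIntegral.tendsto_integral_filter_of_dominated_convergence (fun _ => 1)
    (Eventually.of_forall fun n => (hrm n).aestronglyMeasurable)
    (Eventually.of_forall fun n => ae_of_all _ fun s _ => hg _) intervalIntegrable_const ?_
  filter_upwards [(hc.image ((↑) : ℝ≥0 → ℝ)).ae_notMem volume] with s hs hs0
  rw [Set.uIoc_of_le (Nat.cast_nonneg T)] at hs0
  have hcont : ContinuousAt g s.toNNReal := by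
    by_contra hnc
    exact hs ⟨_, hnc, Real.coe_toNNReal s hs0.1.le⟩
  refine hcont.tendsto.comp ?_
  have h3 := (tendsto_nat_floor_mul_div_atTop hs0.1.le).comp
    (tendsto_natCast_atTop_atTop (R := ℝ))
  rw [← NNReal.tendsto_coe, Real.coe_toNNReal s hs0.1.le]
  simpa [Function.comp_def, mul_comm] using h3

namespace Facility

variable {m : ℕ} {rate : ℝ≥0} {batch : PMF (Fin m → ℕ)} {K : Fin m → ℕ}
  {Ω : Type*} [MeasurableSpace Ω] {P : Measure Ω}

lemma measurable_X_path (F : Facility m rate batch K P) (ω : Ω) :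
    Measurable fun t => F.X t ω :=
  measurable_pi_iff.2 fun i =>
    (measurable_const.add (F.A_path i ω).mono.measurable).sub
      (measurable_const.mul (F.D_path i ω).mono.measurable)

lemma countable_not_continuousAt_X (F : Facility m rate batch K P) (ω : Ω) :
    {t | ¬ ContinuousAt (fun t => F.X t ω) t}.Countable := by
  refine (Set.countable_iUnion fun i => (F.A_path i ω).mono.countable_not_continuousAt.union
    (F.D_path i ω).mono.countable_not_continuousAt).mono fun t ht => ?_
  by_contra hn
  simp only [Set.mem_iUnion, Set.mem_union, Set.mem_ofPred_eq, not_exists, not_or, not_not] at hn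
  refine ht (continuousAt_pi.2 fun i => ?_)
  exact (continuous_of_discreteTopology
    (f := fun q : ℕ × ℕ => F.X₀ ω i + q.1 - K i * q.2)).continuousAt.comp
      (f := fun t => (F.A i t ω, F.D i t ω)) ((hn i).1.prodMk (hn i).2)

/-- Left Riemann sums of a function of the queue-length vector. -/
lemma tendsto_riemannSum_X (F : Facility m rate batch K P) (ω : Ω) {f : (Fin m → ℕ) → ℂ}
    (hf : ∀ x, ‖f x‖ ≤ 1) (T : ℕ) :
    Tendsto (fun n : ℕ => (∑ k ∈ Finset.range (n * T), f (F.X (k / n) ω)) / (n : ℂ)) atTop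
      (𝓝 (∫ s in (0 : ℝ)..T, f (F.X s.toNNReal ω))) := by
  have hc : ∀ t, ContinuousAt (fun t => F.X t ω) t → ContinuousAt (fun t => f (F.X t ω)) t :=
    fun t ht => (continuous_of_discreteTopology (f := f)).continuousAt.comp ht
  exact tendsto_riemannSum (fun t => hf _)
    ((F.countable_not_continuousAt_X ω).mono fun t ht h => ht (hc t h)) T

/-- The time average of a bounded function of the queue-length vector. -/
lemma tendsto_timeAverage (F : Facility m rate batch K P) {p : PMF (Fin m → ℕ)} {ω : Ω}
    (h : ∀ x : Fin m → ℕ, Tendsto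
      (fun T : ℝ => (∫ s in (0 : ℝ)..T, if F.X s.toNNReal ω = x then (1 : ℝ) else 0) / T)
      atTop (𝓝 (p x).toReal)) {f : (Fin m → ℕ) → ℂ} (hf : ∀ x, ‖f x‖ ≤ 1) :
    Tendsto (fun n : ℕ => (∫ s in (0 : ℝ)..n, f (F.X s.toNNReal ω)) / (n : ℂ)) atTop
      (𝓝 (∑' x, (((p x).toReal : ℝ) : ℂ) * f x)) := by
  have hX : Measurable fun s : ℝ => F.X s.toNNReal ω :=
    (F.measurable_X_path ω).comp measurable_real_toNNReal
  -- The occupation measure of the path on `(0, n]`; it is a probability measure only for `n > 0`.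
  set μ : ℕ → Measure (Fin m → ℕ) := fun n => (n : ENNReal)⁻¹ •
    (volume.restrict (Set.Ioc (0 : ℝ) n)).map fun s => F.X s.toNNReal ω with hμ
  have hreal : ∀ n x, (μ n).real {x} =
      (∫ s in (0 : ℝ)..n, if F.X s.toNNReal ω = x then (1 : ℝ) else 0) / n := by
    intro n x
    have hm : MeasurableSet ((fun s : ℝ => F.X s.toNNReal ω) ⁻¹' {x}) :=
      hX (measurableSet_singleton x)
    have h1 : (fun s : ℝ => if F.X s.toNNReal ω = x then (1 : ℝ) else 0) =
        ((fun s : ℝ => F.X s.toNNReal ω) ⁻¹' {x}).indicator fun _ => 1 := by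
      funext s
      by_cases hs : F.X s.toNNReal ω = x <;> simp [hs]
    rw [intervalIntegral.integral_of_le (Nat.cast_nonneg n), h1, integral_indicator_const _ hm,
      hμ, measureReal_ennreal_smul_apply, map_measureReal_apply hX (measurableSet_singleton x)]
    simp
    ring
  have hint : ∀ n, ∫ x, f x ∂μ n = (∫ s in (0 : ℝ)..n, f (F.X s.toNNReal ω)) / (n : ℂ) := by
    intro n
    rw [hμ, integral_smul_measure, integral_map hX.aemeasurable
      (measurable_of_countable f).aestronglyMeasurable,
      intervalIntegral.integral_of_le (Nat.cast_nonneg n), Complex.real_smul]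
    simp
    ring
  simp only [← hint]
  refine tendsto_integral_of_tendsto_measureReal_singleton ?_ p (fun x => ?_) hf
  · filter_upwards [eventually_gt_atTop 0] with n hn
    refine ⟨?_⟩
    rw [hμ, Measure.smul_apply, Measure.map_apply hX MeasurableSet.univ]
    simp [ENNReal.inv_mul_cancel, hn.ne']
  · simp only [hreal]
    exact (h x).comp tendsto_natCast_atTop_atTop

/-- The average over departure epochs of a bounded function of the queue-length vector. -/
lemma tendsto_departureAverage (F : Facility m rate batch K P) {i : Fin m} {p : PMF (Fin m → ℕ)}
    {ω : Ω}
    (h : ∀ x : Fin m → ℕ, Tendsto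
      (fun n : ℕ => (∑ k ∈ Finset.range n,
        if F.X (F.departureEpoch i k ω) ω = x then (1 : ℝ) else 0) / n)
      atTop (𝓝 (p x).toReal)) {f : (Fin m → ℕ) → ℂ} (hf : ∀ x, ‖f x‖ ≤ 1) :
    Tendsto (fun n : ℕ => (∑ k ∈ Finset.range n, f (F.X (F.departureEpoch i k ω) ω)) / (n : ℂ))
      atTop (𝓝 (∑' x, (((p x).toReal : ℝ) : ℂ) * f x)) := by
  set μ : ℕ → Measure (Fin m → ℕ) := fun n => (n : ENNReal)⁻¹ •
    ∑ k ∈ Finset.range n, Measure.dirac (F.X (F.departureEpoch i k ω) ω) with hμ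
  have hreal : ∀ n x, (μ n).real {x} = (∑ k ∈ Finset.range n,
      if F.X (F.departureEpoch i k ω) ω = x then (1 : ℝ) else 0) / n := by
    intro n x
    rw [hμ, measureReal_ennreal_smul_apply, measureReal_def, Measure.finsetSum_apply,
      ENNReal.toReal_sum (fun k _ => measure_ne_top _ _), div_eq_inv_mul]
    simp [Set.indicator_apply, apply_ite ENNReal.toReal]
  have hint : ∀ n, ∫ x, f x ∂μ n =
      (∑ k ∈ Finset.range n, f (F.X (F.departureEpoch i k ω) ω)) / (n : ℂ) := by
    intro n
    rw [hμ, integral_smul_measure, integral_finsetSum_measure, Complex.real_smul, div_eq_inv_mul]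
    · simp
    · exact fun k _ => Integrable.of_bound (measurable_of_countable f).aestronglyMeasurable 1
        (ae_of_all _ hf)
  simp only [← hint]
  refine tendsto_integral_of_tendsto_measureReal_singleton ?_ p (fun x => ?_) hf
  · filter_upwards [eventually_gt_atTop 0] with n hn
    refine ⟨?_⟩
    rw [hμ, Measure.smul_apply, Measure.finsetSum_apply]
    simp [ENNReal.inv_mul_cancel, hn.ne']
  · simp only [hreal]
    exact h x

end Facility

/-! ### Second moments of discrete martingale transforms. -/

/-- The second moment of a centred bounded variable. -/
lemma integral_norm_sub_sq_le {Ω : Type*} [MeasurableSpace Ω] {P : Measure Ω}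
    [IsProbabilityMeasure P] {W : Ω → ℂ} (hW : Measurable W) (hb : ∀ ω, ‖W ω‖ ≤ 1) {c : ℂ}
    (hc : ∫ ω, W ω ∂P = c) : ∫ ω, ‖W ω - c‖ ^ 2 ∂P ≤ 1 - ‖c‖ ^ 2 := by
  have hWi : Integrable W P := Integrable.of_bound hW.aestronglyMeasurable 1 (ae_of_all _ hb)
  have hre : ∫ ω, (W ω * (starRingEnd ℂ) c).re ∂P = ‖c‖ ^ 2 := by
    rw [show ∫ ω, (W ω * (starRingEnd ℂ) c).re ∂P = (∫ ω, W ω * (starRingEnd ℂ) c ∂P).re from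
      integral_re (𝕜 := ℂ) (hWi.mul_const _), integral_mul_const, hc, Complex.mul_conj,
      Complex.ofReal_re, Complex.normSq_eq_norm_sq]
  have hrei : Integrable (fun ω => (W ω * (starRingEnd ℂ) c).re) P := (hWi.mul_const _).re
  calc ∫ ω, ‖W ω - c‖ ^ 2 ∂P
      ≤ ∫ ω, (1 + ‖c‖ ^ 2 - 2 * (W ω * (starRingEnd ℂ) c).re) ∂P := by
        refine integral_mono_of_nonneg (ae_of_all _ fun ω => by positivity)
          ((integrable_const _).sub (hrei.const_mul 2)) (ae_of_all _ fun ω => ?_)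
        simp only
        rw [← Complex.normSq_eq_norm_sq, Complex.normSq_sub, Complex.normSq_eq_norm_sq,
          Complex.normSq_eq_norm_sq]
        have : ‖W ω‖ ^ 2 ≤ 1 := pow_le_one₀ (norm_nonneg _) (hb ω)
        linarith
    _ = 1 - ‖c‖ ^ 2 := by
        rw [integral_sub (integrable_const _) (hrei.const_mul 2), integral_const_mul, hre]
        simp
        ring

/-- Orthogonality of the increments of a martingale transform. -/
lemma integral_norm_sum_sq_le {Ω : Type*} [mΩ : MeasurableSpace Ω] {P : Measure Ω}
    [IsProbabilityMeasure P] {𝒢 : ℕ → MeasurableSpace Ω} (h𝒢 : Monotone 𝒢) (h𝒢Ω : ∀ k, 𝒢 k ≤ mΩ)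
    {Y W : ℕ → Ω → ℂ} (hY : ∀ k, Measurable[𝒢 k] (Y k)) (hYb : ∀ k ω, ‖Y k ω‖ ≤ 1)
    (hW : ∀ k, Measurable[𝒢 (k + 1)] (W k)) (hWb : ∀ k ω, ‖W k ω‖ ≤ 1)
    (hind : ∀ k, Indep (𝒢 k) (MeasurableSpace.comap (W k) inferInstance) P) {c : ℂ}
    (hc : ∀ k, ∫ ω, W k ω ∂P = c) (n : ℕ) :
    ∫ ω, ‖∑ k ∈ Finset.range n, Y k ω * (W k ω - c)‖ ^ 2 ∂P ≤ n * (1 - ‖c‖ ^ 2) := by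
  have hWm : ∀ k, Measurable (W k) := fun k => (hW k).mono (h𝒢Ω _) le_rfl
  have hYm : ∀ k, Measurable (Y k) := fun k => (hY k).mono (h𝒢Ω _) le_rfl
  set Z : ℕ → Ω → ℂ := fun k ω => Y k ω * (W k ω - c) with hZ
  have hZm : ∀ k, Measurable[𝒢 (k + 1)] (Z k) := fun k =>
    ((hY k).mono (h𝒢 k.le_succ) le_rfl).mul ((hW k).sub_const c)
  have hSm : ∀ n, Measurable[𝒢 n] fun ω => ∑ k ∈ Finset.range n, Z k ω := fun n =>
    Finset.measurable_sum _ fun k hk =>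
      (hZm k).mono (h𝒢 (Finset.mem_range.1 hk)) le_rfl
  have hcb : ‖c‖ ≤ 1 := by
    rw [← hc 0]
    simpa using norm_integral_le_of_norm_le_const (μ := P) (ae_of_all _ (hWb 0))
  have hWcb : ∀ k ω, ‖W k ω - c‖ ≤ 2 := fun k ω =>
    (norm_sub_le _ _).trans (by linarith [hWb k ω])
  have hZb : ∀ k ω, ‖Z k ω‖ ≤ 2 := fun k ω => by
    rw [hZ, norm_mul]
    nlinarith [hYb k ω, hWcb k ω, norm_nonneg (Y k ω), norm_nonneg (W k ω - c)]
  have hSb : ∀ n ω, ‖∑ k ∈ Finset.range n, Z k ω‖ ≤ n * 2 := fun n ω => by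
    refine (norm_sum_le _ _).trans ((Finset.sum_le_card_nsmul _ _ 2 fun k _ => hZb k ω).trans ?_)
    simp
  induction n with
  | zero => simp
  | succ n ih =>
    set S : Ω → ℂ := fun ω => ∑ k ∈ Finset.range n, Z k ω with hS
    have hSm' : Measurable S := (hSm n).mono (h𝒢Ω n) le_rfl
    have hZm' : Measurable (Z n) := (hZm n).mono (h𝒢Ω _) le_rfl
    have hS2 : Integrable (fun ω => ‖S ω‖ ^ 2) P :=
      Integrable.of_bound (hSm'.norm.pow_const 2).aestronglyMeasurable ((n * 2) ^ 2)
        (ae_of_all _ fun ω => by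
          rw [norm_pow, norm_norm]
          exact pow_le_pow_left₀ (norm_nonneg _) (hSb n ω) 2)
    have hWc2 : Integrable (fun ω => ‖W n ω - c‖ ^ 2) P :=
      Integrable.of_bound (((hWm n).sub_const c).norm.pow_const 2).aestronglyMeasurable (2 ^ 2)
        (ae_of_all _ fun ω => by
          rw [norm_pow, norm_norm]
          exact pow_le_pow_left₀ (norm_nonneg _) (hWcb n ω) 2)
    have hcr : Integrable (fun ω => S ω * (starRingEnd ℂ) (Z n ω)) P :=
      Integrable.of_bound
        (hSm'.mul (Complex.continuous_conj.measurable.comp hZm')).aestronglyMeasurable (n * 2 * 2)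
        (ae_of_all _ fun ω => by
          rw [norm_mul, RCLike.norm_conj]
          exact mul_le_mul (hSb n ω) (hZb n ω) (norm_nonneg _) (by positivity))
    -- Group `Y n` with the past sum `S`: both are known at stage `n`, while `W n - c` is centred
    -- and independent of that information.
    have hcross : ∫ ω, (S ω * (starRingEnd ℂ) (Z n ω)).re ∂P = 0 := by
      have hi : IndepFun (fun ω => S ω * (starRingEnd ℂ) (Y n ω))
          (fun ω => (starRingEnd ℂ) (W n ω - c)) P := by
        rw [IndepFun_iff_Indep]
        refine indep_of_indep_of_le (hind n) ?_ ?_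
        · exact ((hSm n).mul (Complex.continuous_conj.measurable.comp (hY n))).comap_le
        · exact ((Complex.continuous_conj.measurable.comp
            ((measurable_id (α := ℂ)).sub_const c)).comp (comap_measurable (W n))).comap_le
      have h0 : ∫ ω, (starRingEnd ℂ) (W n ω - c) ∂P = 0 := by
        rw [integral_conj, integral_sub _ (integrable_const c), hc]
        · simp
        · exact Integrable.of_bound (hWm n).aestronglyMeasurable 1 (ae_of_all _ (hWb n))
      have h1 : ∫ ω, S ω * (starRingEnd ℂ) (Z n ω) ∂P = 0 := by
        have h2 := hi.integral_fun_mul_eq_mul_integral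
          (hSm'.mul (Complex.continuous_conj.measurable.comp (hYm n))).aestronglyMeasurable
          (Complex.continuous_conj.measurable.comp ((hWm n).sub_const c)).aestronglyMeasurable
        rw [h0, mul_zero] at h2
        rw [← h2]
        refine integral_congr_ae (ae_of_all _ fun ω => ?_)
        simp only [hZ, map_mul]
        ring
      rw [show ∫ ω, (S ω * (starRingEnd ℂ) (Z n ω)).re ∂P =
        (∫ ω, S ω * (starRingEnd ℂ) (Z n ω) ∂P).re from integral_re (𝕜 := ℂ) hcr, h1,
        Complex.zero_re]
    have hcri : Integrable (fun ω => (S ω * (starRingEnd ℂ) (Z n ω)).re) P := hcr.re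
    calc ∫ ω, ‖∑ k ∈ Finset.range (n + 1), Z k ω‖ ^ 2 ∂P
        ≤ ∫ ω, (‖S ω‖ ^ 2 + ‖W n ω - c‖ ^ 2 + 2 * (S ω * (starRingEnd ℂ) (Z n ω)).re) ∂P := by
          refine integral_mono_of_nonneg (ae_of_all _ fun ω => by positivity)
            ((hS2.add hWc2).add (hcri.const_mul 2)) (ae_of_all _ fun ω => ?_)
          simp only
          rw [Finset.sum_range_succ, ← Complex.normSq_eq_norm_sq, Complex.normSq_add,
            Complex.normSq_eq_norm_sq, Complex.normSq_eq_norm_sq]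
          have : ‖Z n ω‖ ≤ ‖W n ω - c‖ := by
            rw [hZ, norm_mul]
            exact mul_le_of_le_one_left (norm_nonneg _) (hYb n ω)
          have := pow_le_pow_left₀ (norm_nonneg _) this 2
          simp only [hS]
          linarith
      _ = ∫ ω, ‖S ω‖ ^ 2 ∂P + ∫ ω, ‖W n ω - c‖ ^ 2 ∂P := by
          rw [integral_add (f := fun ω => ‖S ω‖ ^ 2 + ‖W n ω - c‖ ^ 2) (hS2.add hWc2)
            (hcri.const_mul 2), integral_add hS2 hWc2,
            integral_const_mul, hcross]
          ring
      _ ≤ n * (1 - ‖c‖ ^ 2) + (1 - ‖c‖ ^ 2) :=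
          add_le_add ih (integral_norm_sub_sq_le (hWm n) (hWb n) (hc n))
      _ = (n + 1 : ℕ) * (1 - ‖c‖ ^ 2) := by
          push_cast
          ring

/-! ### Generating function and variance of the arrivals over a grid. -/

/-- The probability generating function of the Poisson distribution. -/
lemma integral_pow_poissonMeasure (r : ℝ≥0) (w : ℂ) :
    ∫ n, w ^ n ∂poissonMeasure r = Complex.exp (-(r * (1 - w))) := by
  rw [integral_poissonMeasure]
  have h := (NormedSpace.expSeries_div_hasSum_exp ((r : ℂ) * w)).mul_left (Complex.exp (-(r : ℂ)))
  rw [← Complex.exp_eq_exp_ℂ, ← Complex.exp_add] at h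
  rw [show -((r : ℂ) * (1 - w)) = -(r : ℂ) + r * w by ring, ← h.tsum_eq]
  refine tsum_congr fun n => ?_
  rw [Complex.real_smul]
  push_cast
  rw [mul_pow]
  ring

/-- The squared modulus is $e^{-2r(1-\mathrm{Re}\,w)}\ge 1-2r(1-\mathrm{Re}\,w)\ge 1-4r$. This makes
the variance of one grid step linear in its length, so the total does not depend on the mesh. -/
lemma one_sub_norm_exp_sq_le {r : ℝ} (hr : 0 ≤ r) {w : ℂ} (hw : ‖w‖ ≤ 1) :
    1 - ‖Complex.exp (-((r : ℂ) * (1 - w)))‖ ^ 2 ≤ 4 * r := by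
  rw [Complex.norm_exp, ← Real.exp_nat_mul]
  have h1 : (-((r : ℂ) * (1 - w))).re = -(r * (1 - w.re)) := by simp
  rw [h1]
  have h2 := Real.add_one_le_exp ((2 : ℕ) * -(r * (1 - w.re)))
  have h3 := (abs_le.1 ((Complex.abs_re_le_norm w).trans hw)).1
  push_cast at h2 ⊢
  nlinarith

lemma pgf_eq_integral {m : ℕ} (p : PMF (Fin m → ℕ)) {z : Fin m → ℂ} (hz : ∀ i, ‖z i‖ ≤ 1) :
    pgf p z = ∫ x, monom z x ∂p.toMeasure := by
  rw [p.integral_eq_tsum]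
  · simp [pgf, monom]
  · exact Integrable.of_bound (measurable_of_countable _).aestronglyMeasurable 1
      (ae_of_all _ (norm_monom_le_one hz))

lemma norm_pgf_le_one {m : ℕ} (p : PMF (Fin m → ℕ)) {z : Fin m → ℂ} (hz : ∀ i, ‖z i‖ ≤ 1) :
    ‖pgf p z‖ ≤ 1 := by
  rw [pgf_eq_integral p hz]
  simpa using norm_integral_le_of_norm_le_const (μ := p.toMeasure)
    (ae_of_all _ (norm_monom_le_one hz))

lemma measurable_prod_range_monom {m : ℕ} (z : Fin m → ℂ) :
    Measurable fun q : ℕ × (ℕ → Fin m → ℕ) => ∏ k ∈ Finset.range q.1, monom z (q.2 k) :=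
  measurable_from_prod_countable_right fun n => by
    change Measurable fun y : ℕ → Fin m → ℕ => ∏ k ∈ Finset.range n, monom z (y k)
    exact Finset.measurable_prod _ fun k _ =>
      (measurable_of_countable (monom z)).comp (measurable_pi_apply k)

namespace Facility

variable {m : ℕ} {rate : ℝ≥0} {batch : PMF (Fin m → ℕ)} {K : Fin m → ℕ}
  {Ω : Type*} [MeasurableSpace Ω] {P : Measure Ω}

lemma norm_arrivalFactor_le_one (F : Facility m rate batch K P) {z : Fin m → ℂ}
    (hz : ∀ i, ‖z i‖ ≤ 1) (s t : ℝ≥0) (ω : Ω) : ‖F.arrivalFactor z s t ω‖ ≤ 1 :=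
  norm_monom_le_one hz _

/-- Expresses the factor through the batches after time `s` alone, which is the data that
`nonanticipating` makes independent of the past. -/
lemma arrivalFactor_eq_prod (F : Facility m rate batch K P) (z : Fin m → ℂ) {s t : ℝ≥0}
    (hst : s ≤ t) (ω : Ω) : F.arrivalFactor z s t ω =
      ∏ k ∈ Finset.range (F.N t ω - F.N s ω), monom z (F.G (F.N s ω + k) ω) := by
  have hN : F.N s ω ≤ F.N t ω := (F.N_path ω).mono hst
  have h1 : ∀ i, F.A i t ω - F.A i s ω =
      ∑ k ∈ Finset.range (F.N t ω - F.N s ω), F.G (F.N s ω + k) ω i := by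
    intro i
    rw [A, A, ← Finset.sum_range_add_sum_Ico _ hN, Nat.add_sub_cancel_left,
      Finset.sum_Ico_eq_sum_range]
  rw [arrivalFactor]
  simp only [h1, monom]
  rw [Finset.prod_comm]
  exact Finset.prod_congr rfl fun i _ => (Finset.prod_pow_eq_pow_sum _ _ _).symm

lemma measurable_X (F : Facility m rate batch K P) (t : ℝ≥0) : Measurable[F.ℱ t] (F.X t) :=
  (@measurable_pi_iff _ _ _ (F.ℱ t) _ _).2 fun i =>
    ((((measurable_pi_apply i).comp F.X₀_meas).mono (F.ℱ.mono zero_le) le_rfl).add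
      (F.A_adapted i t)).sub (measurable_const.mul (F.D_adapted i t))

lemma measurable_N (F : Facility m rate batch K P) (t : ℝ≥0) : Measurable (F.N t) :=
  (F.N_adapted t).mono (F.ℱ.le t) le_rfl

lemma measurable_arrivalFactor (F : Facility m rate batch K P) (z : Fin m → ℂ) {s t : ℝ≥0}
    (hst : s ≤ t) : Measurable[F.ℱ t] (F.arrivalFactor z s t) := by
  have h : Measurable[F.ℱ t] fun ω i => F.A i t ω - F.A i s ω :=
    (@measurable_pi_iff _ _ _ (F.ℱ t) _ _).2 fun i => (F.A_adapted i t).sub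
      ((F.A_adapted i s).mono (F.ℱ.mono hst) le_rfl)
  exact (measurable_of_countable (monom z)).comp h

lemma indep_arrivalFactor (F : Facility m rate batch K P) (z : Fin m → ℂ) {s t : ℝ≥0}
    (hst : s ≤ t) :
    Indep (F.ℱ s) (MeasurableSpace.comap (F.arrivalFactor z s t) inferInstance) P := by
  refine indep_of_indep_of_le_right (F.nonanticipating s) ?_
  have h : ∀ u : ℝ≥0, Measurable fun q : (ℝ≥0 → ℕ) × (ℕ → Fin m → ℕ) =>
      ∏ k ∈ Finset.range (q.1 u), monom z (q.2 k) := fun u => by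
    have hu : Measurable fun q : (ℝ≥0 → ℕ) × (ℕ → Fin m → ℕ) => (q.1 u, q.2) := by fun_prop
    exact (measurable_prod_range_monom z).comp hu
  have h2 : F.arrivalFactor z s t =
      (fun q : (ℝ≥0 → ℕ) × (ℕ → Fin m → ℕ) =>
        ∏ k ∈ Finset.range (q.1 (t - s)), monom z (q.2 k)) ∘
      fun ω => ((fun t : ℝ≥0 => F.N (s + t) ω - F.N s ω), (fun n : ℕ => F.G (F.N s ω + n) ω)) := by
    funext ω
    rw [F.arrivalFactor_eq_prod z hst, Function.comp_apply]
    simp only [add_tsub_cancel_of_le hst]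
  rw [h2, ← MeasurableSpace.comap_comp]
  exact MeasurableSpace.comap_mono (h _).comap_le

lemma integral_monom_G (F : Facility m rate batch K P) {z : Fin m → ℂ}
    (hz : ∀ i, ‖z i‖ ≤ 1) (n : ℕ) : ∫ ω, monom z (F.G n ω) ∂P = pgf batch z := by
  rw [pgf_eq_integral batch hz, ← F.G_law n, integral_map (F.G_meas n).aemeasurable
    (measurable_of_countable _).aestronglyMeasurable]

lemma integral_prod_monom_G (F : Facility m rate batch K P) {z : Fin m → ℂ}
    (hz : ∀ i, ‖z i‖ ≤ 1) (a n : ℕ) :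
    ∫ ω, ∏ k ∈ Finset.range n, monom z (F.G (a + k) ω) ∂P = pgf batch z ^ n := by
  have h := (F.G_iIndep.precomp (g := fun k : Fin n => a + k)
    fun i j hij => Fin.ext (Nat.add_left_cancel hij)).integral_fun_prod_comp
      (f := fun _ => monom z) (fun k => (F.G_meas _).aemeasurable)
      fun k => (measurable_of_countable _).aestronglyMeasurable
  simp only [F.integral_monom_G hz, Finset.prod_const, Finset.card_univ, Fintype.card_fin] at h
  rw [← h]
  refine integral_congr_ae (ae_of_all _ fun ω => ?_)
  exact Finset.prod_range fun k => monom z (F.G (a + k) ω)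

/-- The generating function of the number of customers that arrive in `(s, t]`. -/
lemma integral_arrivalFactor [IsProbabilityMeasure P] (F : Facility m rate batch K P)
    {z : Fin m → ℂ} (hz : ∀ i, ‖z i‖ ≤ 1) {s t : ℝ≥0} (hst : s ≤ t) :
    ∫ ω, F.arrivalFactor z s t ω ∂P =
      Complex.exp (-(((rate * (t - s) : ℝ≥0) : ℂ) * (1 - pgf batch z))) := by
  -- The sizes of the new batches start at the random index `N s`, so both `N s` and the increment
  -- are fixed first. The sizes are independent of this pair, and by Fubini their product integrates
  -- to `pgf batch z` to the power of the increment, whatever the starting index.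
  set U : Ω → ℕ × ℕ := fun ω => (F.N s ω, F.N t ω - F.N s ω)
  set V : Ω → ℕ → Fin m → ℕ := fun ω n => F.G n ω
  have hUm : Measurable U := (F.measurable_N s).prodMk ((F.measurable_N t).sub (F.measurable_N s))
  have hVm : Measurable V := measurable_pi_iff.2 F.G_meas
  have hind : IndepFun U V P := F.N_indep_G.comp
    (φ := fun f : ℝ≥0 → ℕ => (f s, f t - f s)) (ψ := id)
    ((measurable_pi_apply s).prodMk ((measurable_pi_apply t).sub (measurable_pi_apply s)))
    measurable_id
  set h : (ℕ × ℕ) × (ℕ → Fin m → ℕ) → ℂ :=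
    fun q => ∏ k ∈ Finset.range q.1.2, monom z (q.2 (q.1.1 + k)) with hh
  have hm : Measurable h :=
    measurable_from_prod_countable_right fun q => by
      change Measurable fun y : ℕ → Fin m → ℕ => ∏ k ∈ Finset.range q.2, monom z (y (q.1 + k))
      exact Finset.measurable_prod _ fun k _ =>
        (measurable_of_countable (monom z)).comp (measurable_pi_apply (q.1 + k))
  have hb : ∀ q, ‖h q‖ ≤ 1 := fun q => by
    rw [hh, norm_prod]
    exact Finset.prod_le_one (fun _ _ => norm_nonneg _) fun k _ => norm_monom_le_one hz _
  have hPU : IsProbabilityMeasure (P.map U) := Measure.isProbabilityMeasure_map hUm.aemeasurable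
  have hPV : IsProbabilityMeasure (P.map V) := Measure.isProbabilityMeasure_map hVm.aemeasurable
  have h1 : ∫ ω, F.arrivalFactor z s t ω ∂P = ∫ q, h q ∂(P.map U).prod (P.map V) := by
    rw [← hind.map_prod_eq_prod_map_map hUm.aemeasurable hVm.aemeasurable,
      integral_map (hUm.prodMk hVm).aemeasurable hm.aestronglyMeasurable]
    exact integral_congr_ae (ae_of_all _ fun ω => F.arrivalFactor_eq_prod z hst ω)
  rw [h1, integral_prod _ (Integrable.of_bound hm.aestronglyMeasurable 1 (ae_of_all _ hb))]
  have h2 : ∀ q : ℕ × ℕ, ∫ y, h (q, y) ∂P.map V = pgf batch z ^ q.2 := fun q => by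
    have hq : Measurable fun y => h (q, y) := hm.comp measurable_prodMk_left
    rw [integral_map hVm.aemeasurable hq.aestronglyMeasurable]
    exact F.integral_prod_monom_G hz q.1 q.2
  simp only [h2]
  rw [integral_map hUm.aemeasurable (measurable_of_countable _).aestronglyMeasurable]
  rw [← integral_pow_poissonMeasure, ← F.N_law s t hst,
    integral_map (φ := fun ω => F.N t ω - F.N s ω)
      ((F.measurable_N t).sub (F.measurable_N s)).aemeasurable
      (measurable_of_countable _).aestronglyMeasurable]

/-- The sum of the centred changes of `z ^ X` by the arrivals, over a grid in `[0, T]`, has a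
second moment of order `T`, uniformly in the grid. -/
lemma integral_norm_centred_sum_sq_le [IsProbabilityMeasure P] (F : Facility m rate batch K P)
    {z : Fin m → ℂ} (hz : ∀ i, ‖z i‖ ≤ 1) (T : ℕ) {n : ℕ} (hn : 0 < n) :
    ∫ ω, ‖∑ k ∈ Finset.range (n * T), monom z (F.X (k / n) ω) *
      (F.arrivalFactor z (k / n) ((k + 1 : ℕ) / n) ω -
        Complex.exp (-((rate / n : ℝ) * (1 - pgf batch z))))‖ ^ 2 ∂P ≤ 4 * rate * T := by
  have hn' : (n : ℝ) ≠ 0 := by exact_mod_cast hn.ne'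
  have hle : ∀ k : ℕ, (k : ℝ≥0) / n ≤ ((k + 1 : ℕ) : ℝ≥0) / n := fun k => by
    gcongr
    exact k.le_succ
  refine (integral_norm_sum_sq_le (P := P) (𝒢 := fun k => F.ℱ (k / n))
    (Y := fun k ω => monom z (F.X (k / n) ω))
    (W := fun k => F.arrivalFactor z (k / n) ((k + 1 : ℕ) / n))
    (fun k l hkl => F.ℱ.mono (by gcongr)) (fun k => F.ℱ.le _)
    (fun k => (measurable_of_countable (monom z)).comp (F.measurable_X _))
    (fun k ω => norm_monom_le_one hz _) (fun k => F.measurable_arrivalFactor z (hle k))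
    (fun k ω => F.norm_arrivalFactor_le_one hz _ _ ω)
    (fun k => F.indep_arrivalFactor z (hle k)) (fun k => ?_) (n * T)).trans ?_
  · rw [F.integral_arrivalFactor hz (hle k)]
    have h : ((k + 1 : ℕ) : ℝ≥0) / n - k / n = 1 / n := by
      rw [Nat.cast_succ, add_div, add_tsub_cancel_left]
    rw [h]
    push_cast
    rw [mul_one_div]
  · have h := one_sub_norm_exp_sq_le (r := (rate : ℝ) / n) (by positivity)
      (norm_pgf_le_one batch hz)
    -- There are `n * T` steps, each of variance at most `4 * rate / n`.
    calc ((n * T : ℕ) : ℝ) * _ ≤ ((n * T : ℕ) : ℝ) * (4 * (rate / n)) := by gcongr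
      _ = 4 * rate * T := by
        push_cast
        field_simp

end Facility

/-! ### Long-run arrival and departure rates. -/

lemma hasSum_poisson_mean (r : ℝ≥0) :
    HasSum (fun n : ℕ => Real.exp (-r) * r ^ n / n.factorial * (n : ℝ)) r := by
  have h := (hasSum_one_poissonMeasure r).mul_left (r : ℝ)
  rw [mul_one] at h
  refine (hasSum_nat_add_iff' 1).1 ?_
  rw [Finset.sum_range_one, Nat.cast_zero, mul_zero, sub_zero]
  refine h.congr_fun fun n => ?_
  rw [Nat.factorial_succ]
  push_cast
  field_simp
  exact pow_succ' _ _

lemma integrable_natCast_poissonMeasure (r : ℝ≥0) :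
    Integrable (fun n : ℕ => (n : ℝ)) (poissonMeasure r) := by
  rw [integrable_poissonMeasure_iff]
  simpa using (hasSum_poisson_mean r).summable

lemma integral_natCast_poissonMeasure (r : ℝ≥0) : ∫ n : ℕ, (n : ℝ) ∂poissonMeasure r = r := by
  rw [integral_poissonMeasure]
  simpa using (hasSum_poisson_mean r).tsum_eq

lemma integrable_coord {m : ℕ} {p : PMF (Fin m → ℕ)} {i : Fin m} (h : FiniteMean p i) :
    Integrable (fun x : Fin m → ℕ => (x i : ℝ)) p.toMeasure := by
  refine ⟨(measurable_of_countable _).aestronglyMeasurable, ?_⟩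
  rw [HasFiniteIntegral, lintegral_countable']
  have h1 : ∀ x : Fin m → ℕ, ‖(x i : ℝ)‖ₑ * p.toMeasure {x} =
      ENNReal.ofReal ((p x).toReal * (x i : ℝ)) := fun x => by
    rw [p.toMeasure_apply_singleton x (measurableSet_singleton x),
      ENNReal.ofReal_mul ENNReal.toReal_nonneg, ENNReal.ofReal_toReal (p.apply_ne_top x), mul_comm,
      Real.enorm_of_nonneg (Nat.cast_nonneg _)]
  simp only [h1]
  exact h.tsum_ofReal_lt_top

lemma integral_coord {m : ℕ} {p : PMF (Fin m → ℕ)} {i : Fin m} (h : FiniteMean p i) :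
    ∫ x, (x i : ℝ) ∂p.toMeasure = mean p i := by
  rw [p.integral_eq_tsum _ (integrable_coord h)]
  rfl

namespace Facility

variable {m : ℕ} {rate : ℝ≥0} {batch : PMF (Fin m → ℕ)} {K : Fin m → ℕ}
  {Ω : Type*} [MeasurableSpace Ω] {P : Measure Ω}

/-- The strong law of large numbers for the numbers of batches. -/
lemma ae_tendsto_N_div [IsProbabilityMeasure P] (F : Facility m rate batch K P) :
    ∀ᵐ ω ∂P, Tendsto (fun n : ℕ => (F.N n ω : ℝ) / n) atTop (𝓝 rate) := by
  set Y : ℕ → Ω → ℕ := fun k ω => F.N (k + 1 : ℕ) ω - F.N k ω with hY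
  have hmono : ∀ k : ℕ, (k : ℝ≥0) ≤ (k + 1 : ℕ) := fun k => by exact_mod_cast k.le_succ
  have hYm : ∀ k, Measurable (Y k) := fun k => (F.measurable_N _).sub (F.measurable_N _)
  have hlaw : ∀ k, P.map (Y k) = poissonMeasure rate := fun k => by
    rw [hY, F.N_law _ _ (hmono k)]
    congr 1
    rw [Nat.cast_succ, add_tsub_cancel_left, mul_one]
  have hind : ∀ j k, j < k → IndepFun (Y j) (Y k) P := fun j k hjk => by
    rw [IndepFun_iff_Indep]
    have hle : ((j + 1 : ℕ) : ℝ≥0) ≤ k := by exact_mod_cast hjk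
    refine indep_of_indep_of_le (F.nonanticipating k) ?_ ?_
    · exact (((F.N_adapted _).mono (F.ℱ.mono hle) le_rfl).sub
        ((F.N_adapted _).mono (F.ℱ.mono ((hmono j).trans hle)) le_rfl)).comap_le
    · have h : Measurable fun q : (ℝ≥0 → ℕ) × (ℕ → Fin m → ℕ) => q.1 1 := by fun_prop
      have h2 : Y k = (fun q : (ℝ≥0 → ℕ) × (ℕ → Fin m → ℕ) => q.1 1) ∘ fun ω =>
          ((fun t : ℝ≥0 => F.N (k + t) ω - F.N k ω), (fun n : ℕ => F.G (F.N k ω + n) ω)) := by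
        funext ω
        simp [hY]
      rw [h2, ← MeasurableSpace.comap_comp]
      exact MeasurableSpace.comap_mono h.comap_le
  have hcast : Measurable fun n : ℕ => (n : ℝ) := measurable_of_countable _
  have hident : ∀ k, IdentDistrib (fun ω => (Y k ω : ℝ)) (fun ω => (Y 0 ω : ℝ)) P P := fun k =>
    (IdentDistrib.mk (hYm k).aemeasurable (hYm 0).aemeasurable
      ((hlaw k).trans (hlaw 0).symm)).comp hcast
  have hint : Integrable (fun ω => (Y 0 ω : ℝ)) P := by
    have h := integrable_natCast_poissonMeasure rate
    rw [← hlaw 0] at h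
    exact h.comp_measurable (hYm 0)
  have hmean : ∫ ω, (Y 0 ω : ℝ) ∂P = rate := by
    rw [← integral_natCast_poissonMeasure rate, ← hlaw 0,
      integral_map (hYm 0).aemeasurable hcast.aestronglyMeasurable]
  -- Pairwise independence of the unit increments suffices for this strong law.
  have hlln := strong_law_ae_real (fun k ω => (Y k ω : ℝ)) hint (fun j k hjk => by
    rcases lt_or_gt_of_ne hjk with h | h
    · exact (hind j k h).comp hcast hcast
    · exact ((hind k j h).comp hcast hcast).symm) hident
  rw [hmean] at hlln
  filter_upwards [hlln] with ω hω
  refine hω.congr fun n => ?_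
  congr 1
  have h1 : ∀ k : ℕ, (Y k ω : ℝ) = (F.N (k + 1 : ℕ) ω : ℝ) - F.N k ω := fun k =>
    Nat.cast_sub ((F.N_path ω).mono (hmono k))
  simp only [h1]
  rw [Finset.sum_range_sub fun k : ℕ => (F.N k ω : ℝ)]
  simp [F.N_zero]

/-- The strong law of large numbers for the batch sizes. -/
lemma ae_tendsto_sum_G_div [IsProbabilityMeasure P] (F : Facility m rate batch K P) {i : Fin m}
    (hi : FiniteMean batch i) :
    ∀ᵐ ω ∂P, Tendsto (fun n : ℕ => (∑ k ∈ Finset.range n, (F.G k ω i : ℝ)) / n) atTop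
      (𝓝 (mean batch i)) := by
  have hcast : Measurable fun x : Fin m → ℕ => (x i : ℝ) := measurable_of_countable _
  have hint : Integrable (fun ω => (F.G 0 ω i : ℝ)) P := by
    have h := integrable_coord hi
    rw [← F.G_law 0] at h
    exact h.comp_measurable (F.G_meas 0)
  have hmean : ∫ ω, (F.G 0 ω i : ℝ) ∂P = mean batch i := by
    rw [← integral_coord hi, ← F.G_law 0,
      integral_map (F.G_meas 0).aemeasurable hcast.aestronglyMeasurable]
  rw [← hmean]
  exact strong_law_ae_real (fun k ω => (F.G k ω i : ℝ)) hint
    (fun j k hjk => (F.G_iIndep.indepFun hjk).comp hcast hcast) fun k =>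
      (IdentDistrib.mk (F.G_meas k).aemeasurable (F.G_meas 0).aemeasurable
        ((F.G_law k).trans (F.G_law 0).symm)).comp hcast

/-- The long-run arrival rate of the customers of class `i`. -/
lemma ae_tendsto_A_div [IsProbabilityMeasure P] (F : Facility m rate batch K P) (hrate : 0 < rate)
    {i : Fin m} (hi : FiniteMean batch i) :
    ∀ᵐ ω ∂P, Tendsto (fun n : ℕ => (F.A i n ω : ℝ) / n) atTop (𝓝 (rate * mean batch i)) := by
  filter_upwards [F.ae_tendsto_N_div, F.ae_tendsto_sum_G_div hi] with ω hN hG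
  -- Positivity of the rate lets the law for batch sizes be evaluated along `N n`; then
  -- $A/n=(N/n)(A/N)$.
  have hNtop : Tendsto (fun n : ℕ => F.N n ω) atTop atTop := by
    have h := hN.pos_mul_atTop (NNReal.coe_pos.2 hrate) (tendsto_natCast_atTop_atTop (R := ℝ))
    refine tendsto_natCast_atTop_iff.1 (h.congr' ?_)
    filter_upwards [eventually_gt_atTop 0] with n hn
    have : (n : ℝ) ≠ 0 := by exact_mod_cast hn.ne'
    field_simp
  refine (hN.mul (hG.comp hNtop)).congr' ?_
  filter_upwards [hNtop.eventually_gt_atTop 0] with n hn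
  have : (F.N n ω : ℝ) ≠ 0 := by exact_mod_cast hn.ne'
  simp only [Function.comp_apply, A]
  push_cast
  field_simp

/-- In steady state, the number of customers of class `i` is recurrently bounded. -/
lemma exists_eventually_X_le (F : Facility m rate batch K P) {p : PMF (Fin m → ℕ)} {ω : Ω}
    (h : ∀ x : Fin m → ℕ, Tendsto
      (fun T : ℝ => (∫ s in (0 : ℝ)..T, if F.X s.toNNReal ω = x then (1 : ℝ) else 0) / T)
      atTop (𝓝 (p x).toReal)) (i : Fin m) {δ : ℝ} (hδ : 0 < δ) (hδ1 : δ < 1) :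
    ∃ M : ℕ, ∀ᶠ n : ℕ in atTop, ∃ s : ℝ≥0, (1 - δ) * n ≤ s ∧ s ≤ n ∧ F.X s ω i ≤ M := by
  -- A finite set of states of mass above `1 - δ`; `M` is the largest `i`-th coordinate in it.
  obtain ⟨u, hu⟩ :=
    ((hasSum_toReal p).eventually (lt_mem_nhds (show 1 - δ < 1 by linarith))).exists
  obtain ⟨M, hM⟩ : ∃ M : ℕ, ∀ x ∈ u, x i ≤ M := ⟨u.sup fun x => x i, fun x hx =>
    Finset.le_sup (f := fun x : Fin m → ℕ => x i) hx⟩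
  refine ⟨M, ?_⟩
  set f : (Fin m → ℕ) → ℂ := fun x => if x i ≤ M then 1 else 0 with hf
  have hf1 : ∀ x, ‖f x‖ ≤ 1 := fun x => by
    simp only [hf]
    split_ifs <;> simp
  have hlim := (F.tendsto_timeAverage h hf1).norm
  have hbig : 1 - δ < ‖∑' x, (((p x).toReal : ℝ) : ℂ) * f x‖ := by
    have h1 : ∀ x, (((p x).toReal : ℝ) : ℂ) * f x =
        ((if x i ≤ M then (p x).toReal else 0 : ℝ) : ℂ) := fun x => by
      simp only [hf]
      split_ifs <;> simp
    have h2 : ∀ x, 0 ≤ if x i ≤ M then (p x).toReal else 0 := fun x => by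
      split_ifs <;> simp
    have h3 : Summable fun x => if x i ≤ M then (p x).toReal else 0 :=
      (hasSum_toReal p).summable.of_nonneg_of_le h2 fun x => by
        split_ifs <;> simp
    simp only [h1]
    rw [← Complex.ofReal_tsum, Complex.norm_real]
    refine hu.trans_le (le_trans ?_ (le_abs_self _))
    refine le_trans (Finset.sum_le_sum fun x hx => ?_) (h3.sum_le_tsum u fun x _ => h2 x)
    rw [if_pos (hM x hx)]
  filter_upwards [hlim.eventually (lt_mem_nhds hbig), eventually_gt_atTop 0] with n hn hn0
  -- Otherwise `X i > M` throughout `[(1 - δ) n, n]`, so the time in `[0, n]` with `X i ≤ M` is at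
  -- most `(1 - δ) n`, against the limiting fraction.
  by_contra hcon
  push Not at hcon
  have hnpos : (0 : ℝ) < n := by exact_mod_cast hn0
  have ha0 : 0 ≤ (1 - δ) * n := mul_nonneg (by linarith) hnpos.le
  have han : (1 - δ) * n ≤ n := by nlinarith
  have hmeas : Measurable fun s : ℝ => f (F.X s.toNNReal ω) :=
    (measurable_of_countable f).comp ((F.measurable_X_path ω).comp measurable_real_toNNReal)
  have hii : ∀ a b, IntervalIntegrable (fun s : ℝ => f (F.X s.toNNReal ω)) volume a b :=
    fun a b => (intervalIntegrable_const (c := (1 : ℝ))).mono_fun hmeas.aestronglyMeasurable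
      (ae_of_all _ fun s => by simpa using hf1 _)
  have hzero : ∫ s in ((1 - δ) * n)..n, f (F.X s.toNNReal ω) = 0 := by
    refine intervalIntegral.integral_zero_ae (ae_of_all _ fun s hs => ?_)
    rw [Set.uIoc_of_le han] at hs
    have hs0 : 0 ≤ s := ha0.trans hs.1.le
    have h4 := hcon s.toNNReal (by rw [Real.coe_toNNReal s hs0]; exact hs.1.le)
      (Real.toNNReal_le_iff_le_coe.2 (by simpa using hs.2))
    simp only [hf]
    rw [if_neg (not_le.2 h4)]
  have hle : ‖∫ s in (0 : ℝ)..n, f (F.X s.toNNReal ω)‖ ≤ (1 - δ) * n := by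
    rw [← intervalIntegral.integral_add_adjacent_intervals (hii 0 ((1 - δ) * n)) (hii _ _), hzero,
      add_zero]
    have h5 := intervalIntegral.norm_integral_le_of_norm_le_const (a := 0) (b := (1 - δ) * n)
      (f := fun s : ℝ => f (F.X s.toNNReal ω)) (C := 1) fun s _ => hf1 _
    rwa [one_mul, sub_zero, abs_of_nonneg ha0] at h5
  rw [norm_div, Complex.norm_natCast, lt_div_iff₀ hnpos] at hn
  linarith

/-- In steady state, the queue length of class `i` grows sublinearly. -/
lemma tendsto_X_div (F : Facility m rate batch K P) {p : PMF (Fin m → ℕ)} {ω : Ω}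
    (h : ∀ x : Fin m → ℕ, Tendsto
      (fun T : ℝ => (∫ s in (0 : ℝ)..T, if F.X s.toNNReal ω = x then (1 : ℝ) else 0) / T)
      atTop (𝓝 (p x).toReal)) {i : Fin m} {α : ℝ}
    (hA : Tendsto (fun n : ℕ => (F.A i n ω : ℝ) / n) atTop (𝓝 α)) :
    Tendsto (fun n : ℕ => (F.X n ω i : ℝ) / n) atTop (𝓝 0) := by
  have hα : 0 ≤ α := ge_of_tendsto' hA fun n => by positivity
  refine tendsto_order.2 ⟨fun a ha => Eventually.of_forall fun n => ha.trans_le (by positivity),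
    fun ε hε => ?_⟩
  -- About `α * δ * n` customers arrive in the last fraction `δ` of `[0, n]`. The denominator has `α
  -- + 1` because `α` may be `0`.
  obtain ⟨δ, hδ, hδ1, hδε⟩ : ∃ δ : ℝ, 0 < δ ∧ δ < 1 ∧ α * δ < ε := by
    refine ⟨min (1 / 2) (ε / (2 * (α + 1))), by positivity, ?_, ?_⟩
    · exact (min_le_left _ _).trans_lt (by norm_num)
    · calc α * min (1 / 2) (ε / (2 * (α + 1))) ≤ (α + 1) * (ε / (2 * (α + 1))) :=
            mul_le_mul (by linarith) (min_le_right _ _) (by positivity) (by positivity)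
        _ = ε / 2 := by field_simp
        _ < ε := by linarith
  obtain ⟨M, hM⟩ := F.exists_eventually_X_le h i hδ hδ1
  -- The limit of `A` is known along integer times only, so `(1 - δ) n` is rounded down.
  set b : ℕ → ℕ := fun n => ⌊(1 - δ) * (n : ℝ)⌋₊
  have hbn : Tendsto (fun n => (b n : ℝ) / n) atTop (𝓝 (1 - δ)) :=
    (tendsto_nat_floor_mul_div_atTop (by linarith)).comp tendsto_natCast_atTop_atTop
  have hbtop : Tendsto b atTop atTop :=
    tendsto_nat_floor_atTop.comp
      (tendsto_natCast_atTop_atTop.const_mul_atTop (by linarith : 0 < 1 - δ))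
  have hAb : Tendsto (fun n => (F.A i (b n) ω : ℝ) / n) atTop (𝓝 (α * (1 - δ))) := by
    refine ((hA.comp hbtop).mul hbn).congr' ?_
    filter_upwards [hbtop.eventually_gt_atTop 0] with n hn
    have : (b n : ℝ) ≠ 0 := by exact_mod_cast hn.ne'
    simp only [Function.comp_apply]
    field_simp
  have hlim : Tendsto (fun n : ℕ => (M : ℝ) / n + (F.A i n ω : ℝ) / n - (F.A i (b n) ω : ℝ) / n)
      atTop (𝓝 (0 + α - α * (1 - δ))) :=
    ((tendsto_const_nhds.div_atTop tendsto_natCast_atTop_atTop).add hA).sub hAb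
  filter_upwards [hM, hlim.eventually (gt_mem_nhds (show 0 + α - α * (1 - δ) < ε by linarith))]
    with n ⟨s, hs1, hs2, hs3⟩ hn
  refine lt_of_le_of_lt ?_ hn
  rw [← add_div, ← sub_div]
  refine div_le_div_of_nonneg_right ?_ (Nat.cast_nonneg n)
  have hbs : (b n : ℝ≥0) ≤ s := by
    rw [← NNReal.coe_le_coe, NNReal.coe_natCast]
    exact (Nat.floor_le (mul_nonneg (by linarith) (Nat.cast_nonneg n))).trans hs1
  have h1 : F.A i (b n) ω ≤ F.A i s ω := (F.A_path i ω).mono hbs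
  have h2 : F.D i s ω ≤ F.D i n ω := (F.D_path i ω).mono hs2
  have h3 := Nat.mul_le_mul_left (K i) h2
  have h4 := F.X_add s ω i
  have h5 := F.X_add n ω i
  -- From `s` to `n` the queue grows at most by the arrivals, which are at most those in `(b n, n]`.
  have h6 : F.X n ω i + F.A i (b n) ω ≤ M + F.A i n ω := by omega
  have h7 : (F.X n ω i : ℝ) + F.A i (b n) ω ≤ M + F.A i n ω := by exact_mod_cast h6
  linarith

/-- In steady state, the services of class `i` are completed at the rate at which the customers
arrive. -/
lemma tendsto_D_div (F : Facility m rate batch K P) {p : PMF (Fin m → ℕ)} {ω : Ω}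
    (h : ∀ x : Fin m → ℕ, Tendsto
      (fun T : ℝ => (∫ s in (0 : ℝ)..T, if F.X s.toNNReal ω = x then (1 : ℝ) else 0) / T)
      atTop (𝓝 (p x).toReal)) {i : Fin m} (hK : 0 < K i) {α : ℝ}
    (hA : Tendsto (fun n : ℕ => (F.A i n ω : ℝ) / n) atTop (𝓝 α)) :
    Tendsto (fun n : ℕ => (F.D i n ω : ℝ) / n) atTop (𝓝 (α / K i)) := by
  have hX₀ : Tendsto (fun n : ℕ => (F.X₀ ω i : ℝ) / n) atTop (𝓝 0) :=
    tendsto_const_nhds.div_atTop tendsto_natCast_atTop_atTop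
  have hlim := ((hX₀.add hA).sub (F.tendsto_X_div h hA)).div_const (K i : ℝ)
  rw [zero_add, sub_zero] at hlim
  refine hlim.congr fun n => ?_
  have hK' : (K i : ℝ) ≠ 0 := by exact_mod_cast hK.ne'
  have h1 : (F.X n ω i : ℝ) + K i * F.D i n ω = F.X₀ ω i + F.A i n ω := by
    exact_mod_cast F.X_add n ω i
  rw [← add_div, ← sub_div, ← h1, add_sub_cancel_left]
  field_simp

end Facility

/-! ### Continuous-time limit of the grid sums and vanishing of the averages. -/

lemma tendsto_mul_exp_div_sub_one (w : ℂ) :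
    Tendsto (fun n : ℕ => (n : ℂ) * (Complex.exp (w / n) - 1)) atTop (𝓝 w) := by
  have hn : Tendsto (fun n : ℕ => ‖w‖ / (n : ℝ)) atTop (𝓝 0) :=
    tendsto_const_nhds.div_atTop tendsto_natCast_atTop_atTop
  rw [tendsto_iff_norm_sub_tendsto_zero]
  refine squeeze_zero' (Eventually.of_forall fun _ => norm_nonneg _) ?_
    (by simpa using hn.const_mul ‖w‖)
  filter_upwards [hn.eventually (gt_mem_nhds one_pos), eventually_gt_atTop 0] with n hn1 hn0
  have hn' : (n : ℂ) ≠ 0 := by exact_mod_cast hn0.ne'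
  have hnR : (n : ℝ) ≠ 0 := by exact_mod_cast hn0.ne'
  have h1 : ‖w / n‖ ≤ 1 := by simpa using hn1.le
  have h2 := Complex.norm_exp_sub_one_sub_id_le h1
  rw [show (n : ℂ) * (Complex.exp (w / n) - 1) - w = n * (Complex.exp (w / n) - 1 - w / n) by
    field_simp, norm_mul, Complex.norm_natCast]
  calc (n : ℝ) * ‖Complex.exp (w / n) - 1 - w / n‖ ≤ n * ‖w / n‖ ^ 2 := by gcongr
    _ = ‖w‖ * (‖w‖ / n) := by
      rw [norm_div, Complex.norm_natCast]
      field_simp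

/-- Fatou's lemma for second moments. -/
lemma lintegral_enorm_sq_le_of_ae_tendsto {Ω : Type*} [MeasurableSpace Ω] {P : Measure Ω}
    {g : ℕ → Ω → ℂ} {g' : Ω → ℂ} (hg : ∀ n, AEMeasurable (g n) P)
    (hlim : ∀ᵐ ω ∂P, Tendsto (fun n => g n ω) atTop (𝓝 (g' ω))) {C : ℕ → ENNReal} {D : ENNReal}
    (hC : Tendsto C atTop (𝓝 D)) (hb : ∀ᶠ n in atTop, ∫⁻ ω, ‖g n ω‖ₑ ^ 2 ∂P ≤ C n) :
    ∫⁻ ω, ‖g' ω‖ₑ ^ 2 ∂P ≤ D := by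
  calc ∫⁻ ω, ‖g' ω‖ₑ ^ 2 ∂P = ∫⁻ ω, liminf (fun n => ‖g n ω‖ₑ ^ 2) atTop ∂P := by
        refine lintegral_congr_ae ?_
        filter_upwards [hlim] with ω hω
        exact (((ENNReal.continuous_pow 2).tendsto _).comp hω.enorm).liminf_eq.symm
    _ ≤ liminf (fun n => ∫⁻ ω, ‖g n ω‖ₑ ^ 2 ∂P) atTop :=
        lintegral_liminf_le' fun n => (hg n).enorm.pow_const 2
    _ ≤ liminf C atTop := liminf_le_liminf hb
    _ = D := hC.liminf_eq

namespace Facility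

variable {m : ℕ} {rate : ℝ≥0} {batch : PMF (Fin m → ℕ)} {K : Fin m → ℕ}
  {Ω : Type*} [MeasurableSpace Ω] {P : Measure Ω}

/-- The arrival martingale of `z ^ X`. -/
noncomputable def arrivalMartingale (F : Facility m rate batch K P) (z : Fin m → ℂ) (T : ℕ)
    (ω : Ω) : ℂ :=
  F.compensated z T ω - F.compensated z 0 ω +
    rate * (1 - pgf batch z) * ∫ s in (0 : ℝ)..T, monom z (F.X s.toNNReal ω)

/-- The sum of the centred changes of `z ^ X` by the arrivals, over the grid of mesh `1 / n` in
`[0, T]`. -/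
noncomputable def centredSum (F : Facility m rate batch K P) (z : Fin m → ℂ) (T n : ℕ) (ω : Ω) :
    ℂ :=
  ∑ k ∈ Finset.range (n * T), monom z (F.X (k / n) ω) *
    (F.arrivalFactor z (k / n) ((k + 1 : ℕ) / n) ω -
      Complex.exp (-((rate / n : ℝ) * (1 - pgf batch z))))

lemma measurable_centredSum (F : Facility m rate batch K P) (z : Fin m → ℂ) (T n : ℕ) :
    Measurable (F.centredSum z T n) := by
  refine Finset.measurable_sum _ fun k _ => Measurable.mul ?_ (Measurable.sub_const ?_ _)
  · exact (measurable_of_countable (monom z)).comp ((F.measurable_X _).mono (F.ℱ.le _) le_rfl)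
  · refine (F.measurable_arrivalFactor z ?_).mono (F.ℱ.le _) le_rfl
    gcongr
    exact k.le_succ

lemma lintegral_centredSum_sq_le [IsProbabilityMeasure P] (F : Facility m rate batch K P)
    {z : Fin m → ℂ} (hz : ∀ i, ‖z i‖ ≤ 1) (T : ℕ) {n : ℕ} (hn : 0 < n) :
    ∫⁻ ω, ‖F.centredSum z T n ω‖ₑ ^ 2 ∂P ≤ ENNReal.ofReal (4 * rate * T) := by
  set c : ℂ := Complex.exp (-((rate / n : ℝ) * (1 - pgf batch z)))
  have hb : ∀ ω, ‖F.centredSum z T n ω‖ ≤ (n * T : ℕ) * (1 + ‖c‖) := fun ω => by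
    refine (norm_sum_le _ _).trans ((Finset.sum_le_card_nsmul _ _ (1 + ‖c‖) fun k _ => ?_).trans ?_)
    · rw [norm_mul]
      refine (mul_le_of_le_one_left (norm_nonneg _) (norm_monom_le_one hz _)).trans ?_
      exact (norm_sub_le _ _).trans (by gcongr; exact F.norm_arrivalFactor_le_one hz _ _ ω)
    · rw [Finset.card_range, nsmul_eq_mul]
  have hint : Integrable (fun ω => ‖F.centredSum z T n ω‖ ^ 2) P :=
    Integrable.of_bound ((F.measurable_centredSum z T n).norm.pow_const 2).aestronglyMeasurable
      (((n * T : ℕ) * (1 + ‖c‖)) ^ 2) (ae_of_all _ fun ω => by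
        rw [norm_pow, norm_norm]
        exact pow_le_pow_left₀ (norm_nonneg _) (hb ω) 2)
  refine le_trans (le_of_eq ?_)
    (ENNReal.ofReal_le_ofReal (F.integral_norm_centred_sum_sq_le hz T hn))
  change _ = ENNReal.ofReal (∫ ω, ‖F.centredSum z T n ω‖ ^ 2 ∂P)
  rw [ofReal_integral_eq_lintegral_ofReal hint (ae_of_all _ fun ω => by positivity)]
  refine lintegral_congr fun ω => ?_
  rw [ENNReal.ofReal_pow (norm_nonneg _), ofReal_norm]

/-- The arrival martingale is the limit of the centred sums as the grid is refined. -/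
lemma ae_tendsto_centredSum (F : Facility m rate batch K P) {z : Fin m → ℂ}
    (hz : ∀ i, ‖z i‖ ≤ 1) (T : ℕ) :
    ∀ᵐ ω ∂P, Tendsto (fun n => F.centredSum z T n ω) atTop (𝓝 (F.arrivalMartingale z T ω)) := by
  filter_upwards [F.arrival_ne_completion, F.completion_single] with ω hac hcs
  have h1 := F.tendsto_riemannSum_X ω (norm_monom_le_one hz) T
  -- The centred sum is the increment of `compensated` minus `exp(…) - 1` times the sum of $z^X$
  -- over the grid; the former factor is of order `1 / n` and turns the latter into a Riemann sum.
  have h2 := (tendsto_mul_exp_div_sub_one (-(rate * (1 - pgf batch z)))).mul h1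
  have h3 := (tendsto_const_nhds (x := F.compensated z T ω - F.compensated z 0 ω)).sub h2
  rw [neg_mul, sub_neg_eq_add] at h3
  refine h3.congr' ?_
  filter_upwards [F.eventually_compensated_sub_eq_sum z hac hcs T, eventually_gt_atTop 0]
    with n hn hn0
  have hn' : (n : ℂ) ≠ 0 := by exact_mod_cast hn0.ne'
  have h4 : -((rate : ℂ) * (1 - pgf batch z)) / n =
      -(((rate / n : ℝ) : ℂ) * (1 - pgf batch z)) := by
    push_cast
    ring
  have h5 : ∀ e S : ℂ, n * (e - 1) * (S / n) = S * (e - 1) := fun e S => by field_simp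
  rw [hn, h4, h5, centredSum, Finset.sum_mul, ← Finset.sum_sub_distrib]
  exact Finset.sum_congr rfl fun k _ => by ring

/-- Measurability is inherited from the grid sums, which avoids any measurability argument for the
departure epochs. -/
lemma aemeasurable_arrivalMartingale (F : Facility m rate batch K P) {z : Fin m → ℂ}
    (hz : ∀ i, ‖z i‖ ≤ 1) (T : ℕ) : AEMeasurable (F.arrivalMartingale z T) P :=
  aemeasurable_of_tendsto_metrizable_ae' (fun n => (F.measurable_centredSum z T n).aemeasurable)
    (F.ae_tendsto_centredSum hz T)

lemma lintegral_arrivalMartingale_sq_le [IsProbabilityMeasure P] (F : Facility m rate batch K P)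
    {z : Fin m → ℂ} (hz : ∀ i, ‖z i‖ ≤ 1) (T : ℕ) :
    ∫⁻ ω, ‖F.arrivalMartingale z T ω‖ₑ ^ 2 ∂P ≤ ENNReal.ofReal (4 * rate * T) :=
  lintegral_enorm_sq_le_of_ae_tendsto
    (fun n => (F.measurable_centredSum z T n).aemeasurable) (F.ae_tendsto_centredSum hz T)
    tendsto_const_nhds
    ((eventually_gt_atTop 0).mono fun _ hn => F.lintegral_centredSum_sq_le hz T hn)

/-- The only constant to which the averages of the arrival martingale can converge is `0`. -/
lemma eq_zero_of_tendsto_arrivalMartingale_div [IsProbabilityMeasure P]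
    (F : Facility m rate batch K P) {z : Fin m → ℂ} (hz : ∀ i, ‖z i‖ ≤ 1) {c : ℂ}
    (hc : ∀ᵐ ω ∂P, Tendsto (fun n : ℕ => F.arrivalMartingale z n ω / n) atTop (𝓝 c)) : c = 0 := by
  have hlim : Tendsto (fun n : ℕ => ENNReal.ofReal (4 * rate / n)) atTop (𝓝 0) := by
    have h : Tendsto (fun n : ℕ => 4 * (rate : ℝ) / n) atTop (𝓝 0) :=
      tendsto_const_nhds.div_atTop tendsto_natCast_atTop_atTop
    simpa using ENNReal.tendsto_ofReal h
  -- Fatou along $M(n)/n$, whose second moment is at most $4\lambda n/n^2$.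
  have h := lintegral_enorm_sq_le_of_ae_tendsto (g' := fun _ => c)
    (fun n : ℕ => (F.aemeasurable_arrivalMartingale hz n).div_const (n : ℂ)) hc hlim (by
      filter_upwards [eventually_gt_atTop 0] with n hn
      have hn' : (n : ℝ) ≠ 0 := by exact_mod_cast hn.ne'
      have h1 : ∀ ω, ‖F.arrivalMartingale z n ω / n‖ₑ ^ 2 =
          ENNReal.ofReal ((1 / (n : ℝ)) ^ 2) * ‖F.arrivalMartingale z n ω‖ₑ ^ 2 := fun ω => by
        rw [div_eq_inv_mul, enorm_mul, mul_pow, ENNReal.ofReal_pow (by positivity)]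
        congr 2
        rw [← ofReal_norm, norm_inv, Complex.norm_natCast, one_div]
      simp only [h1]
      rw [lintegral_const_mul' _ _ ENNReal.ofReal_ne_top]
      refine (mul_le_mul_right (F.lintegral_arrivalMartingale_sq_le hz n) _).trans ?_
      rw [← ENNReal.ofReal_mul (by positivity)]
      refine ENNReal.ofReal_le_ofReal (le_of_eq ?_)
      field_simp)
  simpa using h

/-- The contribution of the departures of class `i`, averaged over time. -/
lemma tendsto_departureSum_div (F : Facility m rate batch K P) {i : Fin m} {ω : Ω}
    {p : PMF (Fin m → ℕ)} {α : ℝ} (hα : 0 ≤ α)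
    (hD : Tendsto (fun n : ℕ => (F.D i n ω : ℝ) / n) atTop (𝓝 α))
    (h : α ≠ 0 → ∀ x : Fin m → ℕ, Tendsto
      (fun n : ℕ => (∑ k ∈ Finset.range n,
        if F.X (F.departureEpoch i k ω) ω = x then (1 : ℝ) else 0) / n)
      atTop (𝓝 (p x).toReal)) {z : Fin m → ℂ} (hz : ∀ i, ‖z i‖ ≤ 1) :
    Tendsto (fun n : ℕ => (∑ l ∈ Finset.range (F.D i n ω),
      monom z (F.X (F.departureEpoch i l ω) ω)) / (n : ℂ)) atTop (𝓝 (α * pgf p z)) := by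
  -- If `α = 0`, the sum has `D` terms of modulus at most `1` and vanishes after division, whatever
  -- `p` is. Otherwise `D → ∞`, and the departure average is taken along `D`.
  rcases eq_or_ne α 0 with h0 | h0
  · rw [h0, Complex.ofReal_zero, zero_mul]
    refine squeeze_zero_norm (fun n => ?_) (h0 ▸ hD)
    rw [norm_div, Complex.norm_natCast]
    refine div_le_div_of_nonneg_right ((norm_sum_le _ _).trans ?_) (Nat.cast_nonneg n)
    refine (Finset.sum_le_card_nsmul _ _ 1 fun l _ => norm_monom_le_one hz _).trans ?_
    simp
  · have hDtop : Tendsto (fun n : ℕ => F.D i n ω) atTop atTop := by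
      have h := hD.pos_mul_atTop (lt_of_le_of_ne hα h0.symm)
        (tendsto_natCast_atTop_atTop (R := ℝ))
      refine tendsto_natCast_atTop_iff.1 (h.congr' ?_)
      filter_upwards [eventually_gt_atTop 0] with n hn
      have : (n : ℝ) ≠ 0 := by exact_mod_cast hn.ne'
      field_simp
    have h1 := (F.tendsto_departureAverage (h h0) (norm_monom_le_one hz)).comp hDtop
    have h2 : Tendsto (fun n : ℕ => (((F.D i n ω : ℝ) / n : ℝ) : ℂ)) atTop (𝓝 (α : ℂ)) :=
      (Complex.continuous_ofReal.tendsto α).comp hD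
    refine (h2.mul h1).congr' ?_
    filter_upwards [hDtop.eventually_gt_atTop 0] with n hn
    have : (F.D i n ω : ℂ) ≠ 0 := by exact_mod_cast hn.ne'
    simp only [Function.comp_apply]
    push_cast
    field_simp

end Facility

end BatchService

open BatchService in
/-- Relation between the generating function of the joint queue length in steady state and those
of the joint queue lengths just after the departure epochs of each class, for batch Poisson
arrivals and services in batches of fixed sizes `K i`. -/
theorem mainTheorem3 {m : ℕ} {rate : ℝ≥0} (hrate : 0 < rate)
    {batch : PMF (Fin m → ℕ)} (hbatch : ∀ i, BatchService.FiniteMean batch i)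
    {K : Fin m → ℕ} (hK : ∀ i, 0 < K i)
    {Ω : Type*} [MeasurableSpace Ω] {P : Measure Ω} [IsProbabilityMeasure P]
    (F : BatchService.Facility m rate batch K P)
    (L : PMF (Fin m → ℕ)) (hL : F.IsSteadyState L)
    (Sc : Fin m → PMF (Fin m → ℕ))
    (hSc : ∀ i, BatchService.mean batch i ≠ 0 → F.IsSteadyStateAfterDeparture i (Sc i))
    (z : Fin m → ℂ) (hz : ∀ i, ‖z i‖ ≤ 1) :
    (1 - BatchService.pgf batch z) * BatchService.pgf L z =
      ∑ i, (1 - z i ^ K i) / (K i : ℂ) * (BatchService.mean batch i : ℂ) *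
        BatchService.pgf (Sc i) z := by
  have hrate' : (rate : ℂ) ≠ 0 := by exact_mod_cast hrate.ne'
  have hSc' : ∀ᵐ ω ∂P, ∀ i, mean batch i ≠ 0 → ∀ x : Fin m → ℕ, Tendsto
      (fun n : ℕ => (∑ k ∈ Finset.range n,
        if F.X (F.departureEpoch i k ω) ω = x then (1 : ℝ) else 0) / n)
      atTop (𝓝 (Sc i x).toReal) := by
    refine ae_all_iff.2 fun i => ?_
    by_cases hi : mean batch i = 0
    · exact ae_of_all _ fun ω h => absurd hi h
    · filter_upwards [hSc i hi] with ω hω _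
      exact hω
  -- The zeros in `c` are the limits of $z^{X(n)}/n$ and of the initial term divided by `n`.
  have hzero := F.eq_zero_of_tendsto_arrivalMartingale_div hz
    (c := (0 - ∑ i, (1 - z i ^ K i) * (((rate * mean batch i / K i : ℝ) : ℂ) * pgf (Sc i) z)) - 0 +
      rate * (1 - pgf batch z) * pgf L z) (by
    filter_upwards [hL, hSc', ae_all_iff.2 fun i => F.ae_tendsto_A_div hrate (hbatch i)]
      with ω hLω hScω hAω
    have hconst : ∀ a : ℂ, Tendsto (fun n : ℕ => a / n) atTop (𝓝 0) := fun a =>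
      tendsto_const_div_atTop_nhds_zero_nat a
    have hX : Tendsto (fun n : ℕ => monom z (F.X n ω) / (n : ℂ)) atTop (𝓝 0) := by
      refine squeeze_zero_norm (fun n => ?_) tendsto_one_div_atTop_nhds_zero_nat
      rw [norm_div, Complex.norm_natCast]
      exact div_le_div_of_nonneg_right (norm_monom_le_one hz _) (Nat.cast_nonneg n)
    have hmean : ∀ i, 0 ≤ rate * mean batch i := fun i =>
      ge_of_tendsto' (hAω i) fun n => by positivity
    have hdep := tendsto_finsetSum Finset.univ fun i _ =>
      (F.tendsto_departureSum_div (p := Sc i) (z := z) (div_nonneg (hmean i) (Nat.cast_nonneg _))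
        (F.tendsto_D_div hLω (hK i) (hAω i)) (fun h0 => hScω i fun h => h0 (by simp [h]))
        hz).const_mul (1 - z i ^ K i)
    have htime := F.tendsto_timeAverage hLω (norm_monom_le_one hz)
    refine (((hX.sub hdep).sub (hconst (F.compensated z 0 ω))).add
      (htime.const_mul (rate * (1 - pgf batch z)))).congr fun n => ?_
    simp only [Facility.arrivalMartingale, Facility.compensated, add_div, sub_div, Finset.sum_div,
      mul_div_assoc])
  rw [sub_zero, zero_sub, neg_add_eq_zero] at hzero
  refine mul_left_cancel₀ hrate' ?_
  rw [← mul_assoc, ← hzero, Finset.mul_sum]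
  refine Finset.sum_congr rfl fun i _ => ?_
  push_cast
  ring
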